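/- Let $d, m \ge 0$ be integers and let $\|\cdot\|$ be a strictly convex norm on $\mathbb{R}^d$ (that is, $\|x+y\|<\|x\|+\|y\|$ whenever $x,y\neq 0$ and $x$ is not a real multiple of $y$). Let $\|\cdot\|_2$ be the Euclidean norm, and let $L>1$ satisfy $L^{-1}\|x\|\le\|x\|_2\le L\|x\|$ for all $x\in\mathbb{R}^d$. Notation. $\mathcal{H}^m$ and $H^m$ are the $m$-dimensional Hausdorff measures of the metrics of $\|\cdot\|$ and $\|\cdot\|_2$ respectively, defined from the sums $\sum_i(\operatorname{diam}U_i)^m$ without normalising constant. $B(x,r)$ and $B_2(x,r)$ are the open balls for $\|\cdot\|$ and $\|\cdot\|_2$, and $N_2(A,s)=\{x\in\mathbb{R}^d : \inf_{y\in A}\|x-y\|_2<s\}$. An $m$-set is an $\mathcal{H}^m$-measurable set $A\subset\mathbb{R}^d$ with $0<\mathcal{H}^m(A)<\infty$. An $m$-regular set is an $m$-set $E$ such that $$\Theta^m(E,x)=\lim_{r\to0^+}\frac{\mathcal{H}^m(E\cap B(x,r))}{(2r)^m}$$ exists and equals $1$ for $\mathcal{H}^m$-almost every $x\in E$. An $m$-plane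 is an $m$-dimensional affine subspace of $\mathbb{R}^d$. Statement. Let $E\subset\mathbb{R}^d$ be $m$-regular, let $\eta>0$ and $0<\mu<L^{-2}$. Then there are a number $R>0$ and an $m$-set $E^*\subset E$ with $H^m(E\setminus E^*)<\eta$ such that for every $a\in E^*$ and every $0<r<R$ there is an $m$-plane $V$ with $a\in V$ and 1. $E^*\cap\bigl[B_2(a,r)\setminus N_2(V,\mu r)\bigr]=\emptyset$, and 2. $V\cap B_2(a,r)\subset N_2(E,\mu r)$. -/

import Mathlib

open MeasureTheory Measure Set Filter Metric
open scoped Topology ENNReal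

/-- An `m`-set of a normed (more generally metric) space: a set that is measurable, in the sense of
Carathéodory, with respect to the Hausdorff measure `μH[m]` of the space (the sums
`∑ |Uᵢ| ^ m` of powers of diameters, with no normalising factor), and that has positive and finite
`μH[m]` measure. -/
structure IsMSet {X : Type*} [MetricSpace X] [MeasurableSpace X] [BorelSpace X]
    (m : ℕ) (E : Set X) : Prop where
  measurable : (μH[(m : ℝ)] : Measure X).toOuterMeasure.IsCaratheodory E
  pos : 0 < (μH[(m : ℝ)] : Measure X) E
  lt_top : (μH[(m : ℝ)] : Measure X) E < ∞

/-- `HasUnitDensityAt m E x`: the `m`-dimensional density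
`Θ^m(E, x) = lim_{r → 0+} H^m(E ∩ B(x, r)) / (2 r) ^ m` exists and equals `1`. -/
def HasUnitDensityAt {X : Type*} [MetricSpace X] [MeasurableSpace X] [BorelSpace X]
    (m : ℕ) (E : Set X) (x : X) : Prop :=
  Tendsto (fun r : ℝ => (μH[(m : ℝ)] : Measure X) (E ∩ ball x r) / ENNReal.ofReal ((2 * r) ^ m))
    (𝓝[>] 0) (𝓝 1)

/-- An `m`-regular set: an `m`-set whose `m`-dimensional density exists and equals `1` at
`μH[m]`-almost every one of its points. -/
structure IsMRegular {X : Type*} [MetricSpace X] [MeasurableSpace X] [BorelSpace X]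
    (m : ℕ) (E : Set X) : Prop where
  isMSet : IsMSet m E
  density : ∀ᵐ x ∂(μH[(m : ℝ)] : Measure X), x ∈ E → HasUnitDensityAt m E x

/-- `IsMPlaneThrough m a V`: `V` is an `m`-dimensional affine subspace of `ℝ^d` that contains `a`,
that is, `V ∈ A(a, d, m)`. -/
def IsMPlaneThrough {d : ℕ} (m : ℕ) (a : EuclideanSpace ℝ (Fin d))
    (V : AffineSubspace ℝ (EuclideanSpace ℝ (Fin d))) : Prop :=
  a ∈ V ∧ Module.finrank ℝ V.direction = m

/-! With Hausdorff measure normalised by diameters alone, almost every point of a set of finite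
measure has upper convex density at most 1: small sets `U` around it satisfy `μ U ≤ (1 + ε) (diam
U)^m`. Regularity supplies the matching lower bound on balls. By Egorov both bounds are uniform on a
set `A` carrying almost all of `E`. On a smaller `A'` the set `A` itself has uniform density 1, so
`E \ A` is negligible near points of `A'`. The set `E ∩ A'` serves as `E^*`.

If no radius worked, there would be bad centres in `E ∩ A'` with radii tending to 0. Rescaling and
taking an ultralimit gives a closed set `K` through 0 and a finitely additive `lam` with `lam C ≤
(diam (C ∩ K))^m` for compact `C` and `lam (B(x, r)) ≥ (2r)^m` for `x ∈ K`
(`exists_isUnitDensityContent`).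

Such a `K` is rigid. For `x, y ∈ K` at distance `ρ`, add to the closed ball `B(x, ρ)` a small ball
`B(y, δ)`. By strict convexity the overlap has diameter below `2δ`, so the union weighs more than
`(2ρ)^m` and contains two points of `K` more than `2ρ` apart. One is near `y`; as `δ → 0` the other
is forced to the reflection `2x - y`. Thus `K` is symmetric about each of its points
(`isSymmetricClosed`). A closed set of this kind agrees near 0 with a linear subspace `V`. Counting
covering balls gives `dim V ≥ m`; counting separated lattice points gives `dim V ≤ m` and excludes
points of `K` outside `V` (`exists_submodule_eq`). So `K = V`, and the translates of `V` through the
bad centres are good approximating planes, a contradiction. -/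

/-! ### Upper convex density of sets of finite Hausdorff measure -/

section Density

variable {X : Type*} [MetricSpace X] [MeasurableSpace X] [BorelSpace X]

/-- A Vitali covering argument: if every point of `B` lies in arbitrarily small open sets `U` with
`c * (diam U) ^ m < μ U`, then `c * μH[m] B ≤ μ O` for every open set `O` containing `B`. -/
theorem mul_hausdorffMeasure_le_of_fine_cover (m : ℕ) (μ : Measure X) [IsFiniteMeasure μ]
    {c : ℝ≥0∞} (hc : 1 ≤ c) (hc' : c ≠ ∞) {B O : Set X} (hO : IsOpen O) (hBO : B ⊆ O)
    (hB : ∀ x ∈ B, ∀ δ : ℝ≥0∞, 0 < δ → ∃ U : Set X, IsOpen U ∧ x ∈ U ∧ ediam U < δ ∧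
      c * ediam U ^ m < μ U) :
    c * (μH[(m : ℝ)] : Measure X) B ≤ μ O := by
  have hc0 : c ≠ 0 := (zero_lt_one.trans_le hc).ne'
  have hfine : ∀ x ∈ B, ∀ δ : ℝ≥0∞, 0 < δ → ∃ U : Set X, IsClosed U ∧ U ⊆ O ∧ x ∈ U ∧
      ediam U < δ ∧ c * ediam U ^ m < μ U := by
    intro x hx δ hδ
    obtain ⟨ε, hε, hεO⟩ := EMetric.isOpen_iff.1 hO x (hBO hx)
    obtain ⟨U, hU, hxU, hUd, hUc⟩ := hB x hx (min δ ε) (lt_min hδ hε)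
    refine ⟨closure U, isClosed_closure, ?_, subset_closure hxU, ?_, ?_⟩
    · intro y hy
      refine hεO ?_
      rw [mem_eball]
      refine (edist_le_ediam_of_mem hy (subset_closure hxU)).trans_lt ?_
      rw [ediam_closure]
      exact hUd.trans_le (min_le_right _ _)
    · rw [ediam_closure]
      exact hUd.trans_le (min_le_left _ _)
    · rw [ediam_closure]
      exact hUc.trans_le (measure_mono subset_closure)
  have key : ∀ δ : ℝ, 0 < δ → ∃ (u : Set (Set X)) (_ : Countable u) (t : u → Set X),
      (∀ i, ediam (t i) ≤ ENNReal.ofReal (5 * δ)) ∧ B ⊆ ⋃ i, t i ∧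
      ∑' i, ediam (t i) ^ (m : ℝ) ≤ c⁻¹ * μ O + ENNReal.ofReal δ := by
    intro δ hδ
    let F : Set (Set X) := {U | IsClosed U ∧ U ⊆ O ∧ ediam U ≤ ENNReal.ofReal δ ∧
      c * ediam U ^ m < μ U}
    have hFfin : ∀ U ∈ F, ediam U ≠ ∞ := fun U hU => ne_top_of_le_ne_top ENNReal.ofReal_ne_top hU.2.2.1
    have hFdiam : ∀ U ∈ F, diam U ≤ δ := fun U hU =>
      ENNReal.toReal_le_of_le_ofReal hδ.le hU.2.2.1
    obtain ⟨u, huF, hdisj, hu⟩ := Vitali.exists_disjoint_subfamily_covering_enlargement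
      (fun U : Set X => U) F diam 2 one_lt_two (fun _ _ => diam_nonneg) δ hFdiam (by
        intro U hU
        by_contra h
        have h1 := hU.2.2.2
        rw [not_nonempty_iff_eq_empty.1 h] at h1
        simp at h1)
    have hmeas : ∀ i : u, MeasurableSet (i : Set X) := fun i => (huF i.2).1.measurableSet
    have hdisj' : Pairwise (Function.onFun Disjoint (fun i : u => (i : Set X))) := by
      intro i j hij
      exact hdisj i.2 j.2 (fun h => hij (Subtype.ext h))
    have hcount : Countable u := by
      have := countable_meas_pos_of_disjoint_iUnion (μ := μ) hmeas hdisj'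
      have h2 : {i : u | 0 < μ (i : Set X)} = univ := by
        ext i
        simp only [mem_ofPred_eq, mem_univ, iff_true]
        exact (zero_le).trans_lt (huF i.2).2.2.2
      rw [h2] at this
      exact countable_univ_iff.1 this
    have hsum : c * ∑' i : u, ediam (i : Set X) ^ m ≤ μ O := by
      rw [← ENNReal.tsum_mul_left]
      calc ∑' i : u, c * ediam (i : Set X) ^ m ≤ ∑' i : u, μ (i : Set X) :=
            ENNReal.tsum_le_tsum fun i => (huF i.2).2.2.2.le
        _ = μ (⋃ i : u, (i : Set X)) := (measure_iUnion hdisj' hmeas).symm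
        _ ≤ μ O := measure_mono (iUnion_subset fun i => (huF i.2).2.1)
    have hsum' : ∑' i : u, ediam (i : Set X) ^ m ≤ c⁻¹ * μ O := by
      calc ∑' i : u, ediam (i : Set X) ^ m = c⁻¹ * (c * ∑' i : u, ediam (i : Set X) ^ m) := by
            rw [← mul_assoc, ENNReal.inv_mul_cancel hc0 hc', one_mul]
        _ ≤ _ := by gcongr
    have hsumfin : ∑' i : u, ediam (i : Set X) ^ m ≠ ∞ :=
      ne_top_of_le_ne_top (ENNReal.mul_ne_top (ENNReal.inv_ne_top.2 hc0) (measure_ne_top _ _)) hsum'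
    have hsumfin5 : ∑' i : u, 5 ^ m * ediam (i : Set X) ^ m ≠ ∞ := by
      rw [ENNReal.tsum_mul_left]
      exact ENNReal.mul_ne_top (by simp) hsumfin
    -- Enlarging a Vitali set costs a factor `5^m`. Only the sets outside a finite family `v` are
    -- enlarged, and the tail of the convergent series makes that cost at most `δ`.
    obtain ⟨v, hv⟩ : ∃ v : Finset u, ∑' b : {i : u // i ∉ v}, 5 ^ m * ediam ((b : u) : Set X) ^ m
        ≤ ENNReal.ofReal δ := by
      have := ENNReal.tendsto_tsum_compl_atTop_zero hsumfin5
      exact ((tendsto_order.1 this).2 _ (ENNReal.ofReal_pos.2 hδ)).exists.imp fun _ h => h.le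
    classical
    have h5 : ∀ i : u, ediam (cthickening (2 * diam (i : Set X)) (i : Set X))
        ≤ 5 * ediam (i : Set X) := by
      intro i
      have h1 := ediam_cthickening_le (s := (i : Set X)) (2 * diam (i : Set X)).toNNReal
      rw [Real.coe_toNNReal _ (by positivity)] at h1
      refine h1.trans (le_of_eq ?_)
      have h2 : ((2 * diam (i : Set X)).toNNReal : ℝ≥0∞) = 2 * ediam (i : Set X) := by
        change ENNReal.ofReal _ = _
        rw [ENNReal.ofReal_mul (by norm_num), diam, ENNReal.ofReal_toReal (hFfin _ (huF i.2))]
        simp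
      rw [h2]
      ring
    refine ⟨u, hcount, fun i => if i ∈ v then (i : Set X) else
      cthickening (2 * diam (i : Set X)) (i : Set X), ?_, ?_, ?_⟩
    · intro i
      have hi := (huF i.2).2.2.1
      have h6 : ENNReal.ofReal (5 * δ) = 5 * ENNReal.ofReal δ := by
        rw [ENNReal.ofReal_mul (by norm_num)]; simp
      rw [h6]
      dsimp only
      split_ifs
      · refine hi.trans ?_
        calc ENNReal.ofReal δ = 1 * ENNReal.ofReal δ := (one_mul _).symm
          _ ≤ 5 * ENNReal.ofReal δ := by gcongr; norm_num
      · exact (h5 i).trans (by gcongr)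
    · intro x hx
      by_cases hxv : ∃ i ∈ v, x ∈ (i : Set X)
      · obtain ⟨i, hi, hxi⟩ := hxv
        exact mem_iUnion.2 ⟨i, by simpa [hi] using hxi⟩
      · push Not at hxv
        have hcl : IsClosed (⋃ i ∈ v, (i : Set X)) :=
          isClosed_biUnion_finset fun i _ => (huF i.2).1
        have hxc : x ∈ (⋃ i ∈ v, (i : Set X))ᶜ := by
          simp only [mem_compl_iff, mem_iUnion, not_exists]
          exact hxv
        obtain ⟨ε, hε, hεO⟩ := EMetric.isOpen_iff.1 hcl.isOpen_compl x hxc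
        obtain ⟨U, hUc, hUO, hxU, hUd, hUm⟩ := hfine x hx (min (ENNReal.ofReal δ) ε)
          (lt_min (ENNReal.ofReal_pos.2 hδ) hε)
        obtain ⟨b, hb, ⟨z, hzU, hzb⟩, hbd⟩ := hu U
          ⟨hUc, hUO, (hUd.trans_le (min_le_left _ _)).le, hUm⟩
        -- `U` was chosen too small to reach the closed union of the sets in `v`, so its Vitali
        -- partner is one of the enlarged sets.
        have hbv : (⟨b, hb⟩ : u) ∉ v := by
          intro hbv
          have : z ∈ (⋃ i ∈ v, (i : Set X))ᶜ := by
            refine hεO ?_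
            rw [mem_eball]
            exact (edist_le_ediam_of_mem hzU hxU).trans_lt (hUd.trans_le (min_le_right _ _))
          exact this (mem_biUnion hbv hzb)
        refine mem_iUnion.2 ⟨⟨b, hb⟩, ?_⟩
        simp only [hbv, if_false]
        refine mem_cthickening_of_dist_le x z _ _ hzb (le_trans ?_ hbd)
        exact dist_le_diam_of_mem' (hUd.trans_le (min_le_left _ _)).ne_top hxU hzU
    · have hle : ∀ i : u, ediam (if i ∈ v then (i : Set X) else
          cthickening (2 * diam (i : Set X)) (i : Set X)) ^ (m : ℝ) ≤ ediam (i : Set X) ^ m +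
          ({i | i ∉ v} : Set u).indicator (fun i => 5 ^ m * ediam (i : Set X) ^ m) i := by
        intro i
        rw [ENNReal.rpow_natCast]
        by_cases hi : i ∈ v
        · simp [hi]
        · simp only [hi, if_false, indicator, mem_ofPred_eq, not_false_eq_true, if_true]
          rw [← mul_pow]
          exact (pow_le_pow_left' (h5 i) m).trans le_add_self
      calc _ ≤ ∑' i : u, (ediam (i : Set X) ^ m +
          ({i | i ∉ v} : Set u).indicator (fun i => 5 ^ m * ediam (i : Set X) ^ m) i) :=
            ENNReal.tsum_le_tsum hle
        _ = ∑' i : u, ediam (i : Set X) ^ m +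
          ∑' i : u, ({i | i ∉ v} : Set u).indicator (fun i => 5 ^ m * ediam (i : Set X) ^ m) i :=
            ENNReal.tsum_add
        _ ≤ _ := by
            rw [← tsum_subtype]
            exact add_le_add hsum' hv
  have hpos : ∀ n : ℕ, (0 : ℝ) < 1 / (n + 1) := fun n => Nat.one_div_pos_of_nat
  choose u hu t ht1 ht2 ht3 using fun n : ℕ => key (1 / (n + 1)) (hpos n)
  have hlim : Tendsto (fun n : ℕ => (1 : ℝ) / (n + 1)) atTop (𝓝 0) :=
    tendsto_one_div_add_atTop_nhds_zero_nat
  have h1 := hausdorffMeasure_le_liminf_tsum (m : ℝ) B (l := atTop)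
    (fun n : ℕ => ENNReal.ofReal (5 * (1 / (n + 1)))) (by
      have := ENNReal.tendsto_ofReal (hlim.const_mul 5)
      simpa using this) t (Eventually.of_forall ht1) (Eventually.of_forall ht2)
  have h2 : Tendsto (fun n : ℕ => c⁻¹ * μ O + ENNReal.ofReal (1 / (n + 1))) atTop
      (𝓝 (c⁻¹ * μ O + ENNReal.ofReal 0)) := tendsto_const_nhds.add (ENNReal.tendsto_ofReal hlim)
  have h3 : (μH[(m : ℝ)] : Measure X) B ≤ c⁻¹ * μ O := by
    refine h1.trans ((liminf_le_liminf (Eventually.of_forall ht3)).trans ?_)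
    rw [h2.liminf_eq]
    simp
  calc c * (μH[(m : ℝ)] : Measure X) B ≤ c * (c⁻¹ * μ O) := by gcongr
    _ = μ O := by rw [← mul_assoc, ENNReal.mul_inv_cancel hc0 hc', one_mul]

/-- The set of points contained in an open set `U` of diameter less than `δ` with
`c * (diam U) ^ m < μ U`. -/
def denseCover (m : ℕ) (μ : Measure X) (c δ : ℝ≥0∞) : Set X :=
  ⋃₀ {U : Set X | IsOpen U ∧ ediam U < δ ∧ c * ediam U ^ m < μ U}

omit [BorelSpace X] in
theorem isOpen_denseCover (m : ℕ) (μ : Measure X) (c δ : ℝ≥0∞) :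
    IsOpen (denseCover m μ c δ) :=
  isOpen_sUnion fun _ h => h.1

omit [BorelSpace X] in
theorem denseCover_mono (m : ℕ) (μ : Measure X) (c : ℝ≥0∞) {δ δ' : ℝ≥0∞} (h : δ ≤ δ') :
    denseCover m μ c δ ⊆ denseCover m μ c δ' :=
  sUnion_subset_sUnion fun _ hU => ⟨hU.1, hU.2.1.trans_le h, hU.2.2⟩

/-- Upper density theorem: almost every point of a set of finite Hausdorff measure has upper convex
density at most `1`. -/
theorem ae_exists_notMem_denseCover (m : ℕ) {E : Set X}
    (hE : (μH[(m : ℝ)] : Measure X) E < ∞) {c : ℝ≥0∞} (hc : 1 < c) (hc' : c ≠ ∞) :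
    ∀ᵐ x ∂(μH[(m : ℝ)] : Measure X).restrict E, ∃ n : ℕ,
      x ∉ denseCover m ((μH[(m : ℝ)] : Measure X).restrict E) c (ENNReal.ofReal (1 / (n + 1))) := by
  set μ := (μH[(m : ℝ)] : Measure X).restrict E with hμ
  have : IsFiniteMeasure μ := ⟨by simpa [hμ] using hE⟩
  set B : Set X := ⋂ n : ℕ, denseCover m μ c (ENNReal.ofReal (1 / (n + 1))) with hBdef
  have hBm : MeasurableSet B :=
    MeasurableSet.iInter fun n => (isOpen_denseCover _ _ _ _).measurableSet
  have hB : ∀ x ∈ B ∩ E, ∀ δ : ℝ≥0∞, 0 < δ → ∃ U : Set X, IsOpen U ∧ x ∈ U ∧ ediam U < δ ∧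
      c * ediam U ^ m < μ U := by
    intro x hx δ hδ
    have hlim : Tendsto (fun n : ℕ => ENNReal.ofReal ((1 : ℝ) / (n + 1))) atTop (𝓝 0) := by
      simpa using ENNReal.tendsto_ofReal (tendsto_one_div_add_atTop_nhds_zero_nat (𝕜 := ℝ))
    obtain ⟨n, hn⟩ := ((tendsto_order.1 hlim).2 δ hδ).exists
    obtain ⟨U, ⟨hU1, hU2, hU3⟩, hxU⟩ := mem_iInter.1 hx.1 n
    exact ⟨U, hU1, hxU, hU2.trans hn, hU3⟩
  -- Outer regularity shrinks `O` down to `B` in the covering estimate; as `c > 1`, this leaves only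
  -- `μ B = 0`.
  have hle : c * μ B ≤ μ B := by
    refine ENNReal.le_of_forall_pos_le_add fun ε hε _ => ?_
    obtain ⟨O, hBO, hO, hOle⟩ := B.exists_isOpen_le_add μ (ENNReal.coe_pos.2 hε).ne'
    refine le_trans ?_ hOle
    have := mul_hausdorffMeasure_le_of_fine_cover m μ hc.le hc' hO
      (inter_subset_left.trans hBO) hB
    rwa [hμ, restrict_apply hBm, ← hμ]
  have hzero : μ B = 0 := by
    by_contra h0
    have h1 : 1 * μ B < c * μ B := ENNReal.mul_lt_mul_left h0 (measure_ne_top _ _) hc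
    rw [one_mul] at h1
    exact absurd hle (not_le.2 h1)
  rw [ae_iff]
  convert hzero using 2
  ext x
  simp [hBdef]

end Density

/-! ### Uniform density bounds off a set of small measure -/

section Uniform

variable {X : Type*} [MetricSpace X] [MeasurableSpace X]

/-- The upper convex `m`-density of `μ` is at most `1`, uniformly on `G`. -/
def UniformUpperDensity (m : ℕ) (μ : Measure X) (G : Set X) : Prop :=
  ∀ ε : ℝ, 0 < ε → ∃ R : ℝ, 0 < R ∧ ∀ U : Set X, (U ∩ G).Nonempty → ediam U < ENNReal.ofReal R →
    μ U ≤ ENNReal.ofReal (1 + ε) * ediam U ^ m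

/-- The lower spherical `m`-density of `μ` is at least `1`, uniformly on `G`. -/
def UniformLowerDensity (m : ℕ) (μ : Measure X) (G : Set X) : Prop :=
  ∀ ε : ℝ, 0 < ε → ∃ R : ℝ, 0 < R ∧ ∀ x ∈ G, ∀ r : ℝ, 0 < r → r < R →
    ENNReal.ofReal ((1 - ε) * (2 * r) ^ m) ≤ μ (ball x r)

/-- The lower spherical `m`-density of `μ` at `x` is at least `1`. -/
def LowerDensityAt (m : ℕ) (μ : Measure X) (x : X) : Prop :=
  ∀ ε : ℝ, 0 < ε → ∀ᶠ r in 𝓝[>] (0 : ℝ), ENNReal.ofReal ((1 - ε) * (2 * r) ^ m) ≤ μ (ball x r)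

/-- Egorov's theorem for countably many countable increasing covers of almost all the space. -/
theorem exists_measurableSet_subset_of_monotone {Ω : Type*} [MeasurableSpace Ω] (μ : Measure Ω)
    [IsFiniteMeasure μ] (A : ℕ → ℕ → Set Ω) (hA : ∀ k n, MeasurableSet (A k n))
    (hmono : ∀ k, Monotone (A k)) (hae : ∀ k, ∀ᵐ x ∂μ, ∃ n, x ∈ A k n) {η : ℝ≥0∞} (hη : 0 < η) :
    ∃ S, MeasurableSet S ∧ μ Sᶜ < η ∧ ∀ k, ∃ n, S ⊆ A k n := by
  obtain ⟨δ, hδ, hδs⟩ := ENNReal.exists_pos_sum_of_countable' hη.ne' ℕ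
  have h : ∀ k, ∃ n, μ (A k n)ᶜ < δ k := by
    intro k
    have h1 := tendsto_measure_iInter_atTop (μ := μ) (s := fun n => (A k n)ᶜ)
      (fun n => (hA k n).compl.nullMeasurableSet)
      (fun i j hij => compl_subset_compl.2 (hmono k hij)) ⟨0, measure_ne_top _ _⟩
    have h2 : μ (⋂ n, (A k n)ᶜ) = 0 := by
      have := hae k
      rw [ae_iff] at this
      convert this using 2
      ext x
      simp
    rw [h2] at h1
    exact ((tendsto_order.1 h1).2 _ (hδ k)).exists
  choose n hn using h
  refine ⟨⋂ k, A k (n k), MeasurableSet.iInter fun k => hA k _, ?_,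
    fun k => ⟨n k, iInter_subset _ k⟩⟩
  rw [compl_iInter]
  exact (measure_iUnion_le _).trans_lt ((ENNReal.tsum_le_tsum fun k => (hn k).le).trans_lt hδs)

/-- A thin open thickening of `U` still has diameter below `δ`, so violating the bound would put `x`
in the cover; let the thickness tend to 0. This passes from open sets to arbitrary ones. -/
theorem measure_le_of_notMem_denseCover {m : ℕ} {μ : Measure X} {c δ : ℝ≥0∞} {x : X}
    (hc : c ≠ ∞) (hx : x ∉ denseCover m μ c δ) {U : Set X} (hxU : x ∈ U) (hU : ediam U < δ) :
    μ U ≤ c * ediam U ^ m := by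
  have hlim : Tendsto (fun t : ℝ => ediam U + 2 * ENNReal.ofReal t) (𝓝[>] 0) (𝓝 (ediam U)) := by
    have h1 : Tendsto (fun t : ℝ => ENNReal.ofReal t) (𝓝[>] 0) (𝓝 0) := by
      have := (ENNReal.continuous_ofReal.tendsto 0).mono_left (nhdsWithin_le_nhds (s := Ioi 0))
      simpa using this
    have h2 := ENNReal.Tendsto.const_mul (a := 2) h1 (Or.inr (by simp))
    simpa using (tendsto_const_nhds (x := ediam U)).add h2
  have hlim2 : Tendsto (fun t : ℝ => c * (ediam U + 2 * ENNReal.ofReal t) ^ m) (𝓝[>] 0)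
      (𝓝 (c * ediam U ^ m)) :=
    ENNReal.Tendsto.const_mul (((ENNReal.continuous_pow m).tendsto _).comp hlim) (Or.inr hc)
  refine ge_of_tendsto hlim2 ?_
  filter_upwards [(tendsto_order.1 hlim).2 δ hU, self_mem_nhdsWithin] with t ht ht0
  have ht0' : (0 : ℝ) < t := ht0
  have hd : ediam (thickening t U) ≤ ediam U + 2 * ENNReal.ofReal t := by
    have := ediam_thickening_le (s := U) t.toNNReal
    rwa [Real.coe_toNNReal _ ht0'.le] at this
  refine (measure_mono (self_subset_thickening ht0' U)).trans ?_
  by_contra! h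
  refine hx ⟨thickening t U, ⟨isOpen_thickening, hd.trans_lt ht, lt_of_le_of_lt ?_ h⟩,
    self_subset_thickening ht0' U hxU⟩
  gcongr

theorem exists_uniformUpperDensity [BorelSpace X] (m : ℕ) {E : Set X}
    (hE : (μH[(m : ℝ)] : Measure X) E < ∞) {η : ℝ≥0∞} (hη : 0 < η) :
    ∃ S, MeasurableSet S ∧ (μH[(m : ℝ)] : Measure X).restrict E Sᶜ < η ∧
      UniformUpperDensity m ((μH[(m : ℝ)] : Measure X).restrict E) S := by
  set μ := (μH[(m : ℝ)] : Measure X).restrict E with hμ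
  have : IsFiniteMeasure μ := ⟨by simpa [hμ] using hE⟩
  obtain ⟨S, hS, hSη, hSA⟩ := exists_measurableSet_subset_of_monotone μ
    (fun k n => (denseCover m μ (ENNReal.ofReal (1 + 1 / (k + 1)))
      (ENNReal.ofReal (1 / (n + 1))))ᶜ)
    (fun k n => (isOpen_denseCover _ _ _ _).measurableSet.compl)
    (fun k i j hij => compl_subset_compl.2 (denseCover_mono _ _ _
      (ENNReal.ofReal_le_ofReal (Nat.one_div_le_one_div hij))))
    (fun k => ae_exists_notMem_denseCover m hE (by
      rw [← ENNReal.ofReal_one]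
      exact (ENNReal.ofReal_lt_ofReal_iff (by positivity)).2
        (lt_add_of_pos_right _ Nat.one_div_pos_of_nat)) ENNReal.ofReal_ne_top) hη
  refine ⟨S, hS, hSη, fun ε hε => ?_⟩
  obtain ⟨k, hk⟩ := exists_nat_one_div_lt hε
  obtain ⟨n, hn⟩ := hSA k
  refine ⟨1 / (n + 1), Nat.one_div_pos_of_nat, fun U ⟨x, hxU, hxS⟩ hU => ?_⟩
  refine (measure_le_of_notMem_denseCover ENNReal.ofReal_ne_top (hn hxS) hxU hU).trans ?_
  gcongr

/-- Egorov is applied with rational radii only, which keeps the sets measurable; rational radii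
increasing to `r` then recover every real radius. -/
theorem exists_uniformLowerDensity [BorelSpace X] [SecondCountableTopology X] (m : ℕ)
    (μ : Measure X) [IsFiniteMeasure μ] (h : ∀ᵐ x ∂μ, LowerDensityAt m μ x)
    {η : ℝ≥0∞} (hη : 0 < η) :
    ∃ S, MeasurableSet S ∧ μ Sᶜ < η ∧ UniformLowerDensity m μ S := by
  have hball : ∀ r : ℝ, Measurable fun x : X => μ (ball x r) := by
    intro r
    have : IsOpen {p : X × X | dist p.2 p.1 < r} :=
      isOpen_lt (continuous_snd.dist continuous_fst) continuous_const
    exact measurable_measure_prodMk_left this.measurableSet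
  obtain ⟨S, hS, hSη, hSA⟩ := exists_measurableSet_subset_of_monotone μ
    (fun k n => ⋂ q : ℚ, {x : X | 0 < (q : ℝ) → (q : ℝ) < 1 / (n + 1) →
      ENNReal.ofReal ((1 - 1 / (k + 1)) * (2 * q) ^ m) ≤ μ (ball x q)})
    (fun k n => MeasurableSet.iInter fun q => by
      by_cases h1 : 0 < (q : ℝ) ∧ (q : ℝ) < 1 / (n + 1)
      · simp only [h1.1, h1.2, true_implies]
        exact measurableSet_le measurable_const (hball q)
      · convert MeasurableSet.univ
        exact eq_univ_of_forall fun x h2 h3 => absurd ⟨h2, h3⟩ h1)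
    (fun k i j hij => iInter_mono fun q x hx h1 h2 =>
      hx h1 (h2.trans_le (Nat.one_div_le_one_div hij)))
    (fun k => h.mono fun x hx => by
      have := hx (1 / (k + 1)) Nat.one_div_pos_of_nat
      rw [eventually_nhdsWithin_iff, Metric.eventually_nhds_iff] at this
      obtain ⟨δ, hδ, H⟩ := this
      obtain ⟨n, hn⟩ := exists_nat_one_div_lt hδ
      refine ⟨n, mem_iInter.2 fun q h1 h2 => H ?_ h1⟩
      rw [Real.dist_eq, sub_zero, abs_of_pos h1]
      exact h2.trans hn) hη
  refine ⟨S, hS, hSη, fun ε hε => ?_⟩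
  obtain ⟨k, hk⟩ := exists_nat_one_div_lt hε
  obtain ⟨n, hn⟩ := hSA k
  refine ⟨1 / (n + 1), Nat.one_div_pos_of_nat, fun x hx r hr hrn => ?_⟩
  obtain ⟨u, -, hu, hlim⟩ := Real.exists_seq_rat_strictMono_tendsto r
  have hlim' : Tendsto (fun i => ENNReal.ofReal ((1 - 1 / (k + 1)) * (2 * (u i : ℝ)) ^ m)) atTop
      (𝓝 (ENNReal.ofReal ((1 - 1 / (k + 1)) * (2 * r) ^ m))) :=
    ENNReal.tendsto_ofReal (((hlim.const_mul 2).pow m).const_mul _)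
  refine le_trans (ENNReal.ofReal_le_ofReal (by gcongr)) (le_of_tendsto hlim' ?_)
  filter_upwards [(tendsto_order.1 hlim).1 0 hr] with i hi
  refine (mem_iInter.1 (hn hx) (u i) hi ((hu i).trans hrn)).trans ?_
  exact measure_mono (ball_subset_ball (hu i).le)

end Uniform

/-! ### Densities of regular sets and of their large subsets -/

theorem HasUnitDensityAt.lowerDensityAt {X : Type*} [MetricSpace X] [MeasurableSpace X]
    [BorelSpace X] {m : ℕ} {E : Set X} {x : X} (h : HasUnitDensityAt m E x) :
    LowerDensityAt m ((μH[(m : ℝ)] : Measure X).restrict E) x := by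
  intro ε hε
  have h1 : ENNReal.ofReal (1 - ε) < 1 := by
    rw [← ENNReal.ofReal_one, ENNReal.ofReal_lt_ofReal_iff one_pos]
    linarith
  filter_upwards [(tendsto_order.1 h).1 _ h1, self_mem_nhdsWithin] with r hr hr0
  have hr0' : (0 : ℝ) < r := hr0
  rw [Measure.restrict_apply measurableSet_ball, inter_comm, ENNReal.ofReal_mul' (by positivity)]
  exact ENNReal.mul_le_of_le_div hr.le

/-- By the Besicovitch density theorem, almost every point of `A` sees asymptotically all of the
mass of `μ` inside `A`. -/
theorem ae_restrict_lowerDensityAt {X : Type*} [MetricSpace X] [MeasurableSpace X]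
    [BorelSpace X] [SecondCountableTopology X] [HasBesicovitchCovering X] {m : ℕ} {μ : Measure X}
    [IsFiniteMeasure μ] (h : ∀ᵐ x ∂μ, LowerDensityAt m μ x) (A : Set X) :
    ∀ᵐ x ∂μ.restrict A, LowerDensityAt m (μ.restrict A) x := by
  filter_upwards [Besicovitch.ae_tendsto_measure_inter_div μ A, ae_restrict_of_ae h] with x hx hl
  intro ε hε
  -- One factor `θ` pays for the proportion of mass in `A`, one for the lower density of `μ`, and
  -- `θ^m` for shrinking the radius so that a closed ball fits into the open one.
  obtain ⟨θ, hθε, hθ0, hθ1⟩ : ∃ θ : ℝ, 1 - ε < θ * θ * θ ^ m ∧ 0 < θ ∧ θ < 1 := by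
    have hc : Tendsto (fun θ : ℝ => θ * θ * θ ^ m) (𝓝[<] 1) (𝓝 (1 * 1 * 1 ^ m)) :=
      Tendsto.mono_left (Continuous.tendsto (by fun_prop) 1) nhdsWithin_le_nhds
    have h1 := (tendsto_order.1 hc).1 (1 - ε) (by simpa using hε)
    have h2 : ∀ᶠ θ : ℝ in 𝓝[<] 1, 0 < θ := nhdsWithin_le_nhds (lt_mem_nhds one_pos)
    obtain ⟨θ, h3, h4, h5⟩ := (h1.and (h2.and self_mem_nhdsWithin)).exists
    exact ⟨θ, h3, h4, h5⟩
  have hev1 : ∀ᶠ r in 𝓝[>] (0 : ℝ), ENNReal.ofReal θ * μ (closedBall x r) ≤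
      μ (A ∩ closedBall x r) := by
    have h1 : ENNReal.ofReal θ < 1 := by
      rw [← ENNReal.ofReal_one, ENNReal.ofReal_lt_ofReal_iff one_pos]
      exact hθ1
    filter_upwards [(tendsto_order.1 hx).1 _ h1] with r hr
    exact ENNReal.mul_le_of_le_div hr.le
  have hev := hev1.and (hl (1 - θ) (by linarith))
  have hscale : Tendsto (fun r : ℝ => θ * r) (𝓝[>] 0) (𝓝[>] 0) := by
    refine tendsto_nhdsWithin_iff.2 ⟨?_, ?_⟩
    · have : Tendsto (fun r : ℝ => θ * r) (𝓝 0) (𝓝 (θ * 0)) := tendsto_id.const_mul θ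
      rw [mul_zero] at this
      exact this.mono_left nhdsWithin_le_nhds
    · filter_upwards [self_mem_nhdsWithin] with r hr
      exact mul_pos hθ0 hr
  filter_upwards [hscale.eventually hev, self_mem_nhdsWithin] with r ⟨h1, h2⟩ hr
  have hr0 : (0 : ℝ) < r := hr
  calc ENNReal.ofReal ((1 - ε) * (2 * r) ^ m)
      ≤ ENNReal.ofReal (θ * ((1 - (1 - θ)) * (2 * (θ * r)) ^ m)) := by
        refine ENNReal.ofReal_le_ofReal ?_
        have : θ * ((1 - (1 - θ)) * (2 * (θ * r)) ^ m) = (θ * θ * θ ^ m) * (2 * r) ^ m := by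
          rw [show 2 * (θ * r) = θ * (2 * r) by ring, mul_pow]; ring
        rw [this]
        gcongr
    _ = ENNReal.ofReal θ * ENNReal.ofReal ((1 - (1 - θ)) * (2 * (θ * r)) ^ m) :=
        ENNReal.ofReal_mul hθ0.le
    _ ≤ ENNReal.ofReal θ * μ (closedBall x (θ * r)) := by
        gcongr
        exact h2.trans (measure_mono ball_subset_closedBall)
    _ ≤ μ (A ∩ closedBall x (θ * r)) := h1
    _ ≤ μ.restrict A (ball x r) := by
        rw [Measure.restrict_apply measurableSet_ball, inter_comm]
        gcongr
        exact closedBall_subset_ball (by nlinarith)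

/-- Testing the Carathéodory condition on a measurable hull of `E` shows that the hull exceeds `E`
by a null set, since `μ E` is finite. -/
theorem nullMeasurableSet_of_isCaratheodory {X : Type*} [MeasurableSpace X] {μ : Measure X}
    {E : Set X} (hE : μ.toOuterMeasure.IsCaratheodory E) (hfin : μ E ≠ ∞) :
    NullMeasurableSet E μ := by
  have h1 := hE (toMeasurable μ E)
  simp only [Measure.coe_toOuterMeasure] at h1
  rw [measure_toMeasurable, inter_eq_self_of_subset_right (subset_toMeasurable μ E)] at h1
  have h2 : μ (toMeasurable μ E \ E) = 0 := by
    have h3 : μ E + 0 = μ E + μ (toMeasurable μ E \ E) := by rw [add_zero]; exact h1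
    exact ((ENNReal.add_right_inj hfin).1 h3).symm
  have h3 : (toMeasurable μ E : Set X) =ᵐ[μ] E := by
    refine (ae_le_set.2 h2).antisymm ?_
    exact (subset_toMeasurable μ E).eventuallyLE
  exact (measurableSet_toMeasurable μ E).nullMeasurableSet.congr h3

/-- Uniform densities for regular sets, up to a set of small measure. -/
theorem IsMRegular.exists_uniformDensity {X : Type*} [MetricSpace X] [MeasurableSpace X]
    [BorelSpace X] [SecondCountableTopology X] [HasBesicovitchCovering X] {m : ℕ} {E : Set X}
    (hE : IsMRegular m E) {η : ℝ≥0∞} (hη : 0 < η) (μ : Measure X)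
    (hμ : μ = (μH[(m : ℝ)] : Measure X).restrict E) :
    ∃ A A' : Set X, MeasurableSet A ∧ MeasurableSet A' ∧ A' ⊆ A ∧ μ A'ᶜ < η ∧
      UniformUpperDensity m μ A ∧ UniformLowerDensity m μ A ∧
      UniformLowerDensity m (μ.restrict A) A' := by
  have : IsFiniteMeasure μ := ⟨by simpa [hμ] using hE.isMSet.lt_top⟩
  have hη4 : 0 < η / 4 := ENNReal.div_pos hη.ne' (by simp)
  have hlow : ∀ᵐ x ∂μ, LowerDensityAt m μ x := by
    have hnull := nullMeasurableSet_of_isCaratheodory hE.isMSet.measurable hE.isMSet.lt_top.ne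
    rw [hμ, ae_restrict_iff'₀ hnull]
    filter_upwards [hE.density] with x hx hxE
    exact (hx hxE).lowerDensityAt
  obtain ⟨A₁, hA₁, hA₁η, hup⟩ := exists_uniformUpperDensity m hE.isMSet.lt_top hη4
  rw [← hμ] at hA₁η hup
  obtain ⟨A₂, hA₂, hA₂η, hlo⟩ := exists_uniformLowerDensity m μ hlow hη4
  -- A further Egorov step, for `μ` restricted to the good set: near the surviving points the good
  -- set carries nearly all of the mass.
  obtain ⟨A₃, hA₃, hA₃η, hlo'⟩ := exists_uniformLowerDensity m (μ.restrict (A₁ ∩ A₂))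
    (ae_restrict_lowerDensityAt hlow _) hη4
  refine ⟨A₁ ∩ A₂, A₁ ∩ A₂ ∩ A₃, hA₁.inter hA₂, (hA₁.inter hA₂).inter hA₃, inter_subset_left, ?_,
    fun ε hε => ?_, fun ε hε => ?_, fun ε hε => ?_⟩
  · have h1 : (A₁ ∩ A₂ ∩ A₃)ᶜ ⊆ A₁ᶜ ∪ A₂ᶜ ∪ (A₃ᶜ ∩ (A₁ ∩ A₂)) := by
      intro x hx
      simp only [mem_compl_iff, mem_inter_iff, mem_union] at hx ⊢
      tauto
    rw [Measure.restrict_apply hA₃.compl] at hA₃η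
    by_cases hη' : η = ∞
    · rw [hη']; exact measure_lt_top _ _
    calc μ (A₁ ∩ A₂ ∩ A₃)ᶜ ≤ μ A₁ᶜ + μ A₂ᶜ + μ (A₃ᶜ ∩ (A₁ ∩ A₂)) :=
          (measure_mono h1).trans ((measure_union_le _ _).trans
            (by gcongr; exact measure_union_le _ _))
      _ < η / 4 + η / 4 + η / 4 := by
          exact ENNReal.add_lt_add (ENNReal.add_lt_add hA₁η hA₂η) hA₃η
      _ ≤ η / 4 + η / 4 + η / 4 + η / 4 := le_self_add
      _ = 4 * (η / 4) := by ring
      _ = η := ENNReal.mul_div_cancel (by simp) (by simp)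
  · obtain ⟨R, hR, h⟩ := hup ε hε
    exact ⟨R, hR, fun U hU => h U (hU.mono (by gcongr; exact inter_subset_left))⟩
  · obtain ⟨R, hR, h⟩ := hlo ε hε
    exact ⟨R, hR, fun x hx => h x hx.2⟩
  · obtain ⟨R, hR, h⟩ := hlo' ε hε
    exact ⟨R, hR, fun x hx => h x hx.2⟩

/-! ### Closed sets symmetric about each of their points -/

section Symmetric

variable {X : Type*} [NormedAddCommGroup X] [NormedSpace ℝ X]

/-- A closed set containing the origin that is symmetric about each of its points. -/
structure IsSymmetricClosed (K : Set X) : Prop where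
  isClosed : IsClosed K
  zero_mem : (0 : X) ∈ K
  two_smul_sub_mem : ∀ x ∈ K, ∀ y ∈ K, (2 : ℝ) • x - y ∈ K

namespace IsSymmetricClosed

variable {K : Set X} (hK : IsSymmetricClosed K)
include hK

theorem neg_mem {x : X} (hx : x ∈ K) : -x ∈ K := by
  simpa using hK.two_smul_sub_mem 0 hK.zero_mem x hx

/-- The reflections in `0` and in `x` compose to the translation by `2x`; hence the factors 2 below.
-/
theorem two_smul_add_mem {x y : X} (hx : x ∈ K) (hy : y ∈ K) : (2 : ℝ) • x + y ∈ K := by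
  simpa using hK.two_smul_sub_mem x hx (-y) (hK.neg_mem hy)

theorem nat_smul_add_mem {x y : X} (hx : x ∈ K) (hy : y ∈ K) (n : ℕ) :
    (n : ℝ) • ((2 : ℝ) • x) + y ∈ K := by
  induction n with
  | zero => simpa using hy
  | succ n ih =>
    have := hK.two_smul_add_mem hx ih
    convert this using 1
    push_cast
    module

theorem int_smul_add_mem {x y : X} (hx : x ∈ K) (hy : y ∈ K) (n : ℤ) :
    (n : ℝ) • ((2 : ℝ) • x) + y ∈ K := by
  obtain ⟨k, rfl | rfl⟩ := n.eq_nat_or_neg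
  · simpa using hK.nat_smul_add_mem hx hy k
  · have := hK.nat_smul_add_mem (hK.neg_mem hx) hy k
    simpa using this

/-- The largest linear subspace contained in a closed symmetric set. -/
def lineality : Submodule ℝ X where
  carrier := {v | ∀ t : ℝ, t • v ∈ K}
  zero_mem' t := by simpa using hK.zero_mem
  add_mem' {v w} hv hw t := by
    have := hK.two_smul_add_mem (hv (t / 2)) (hw t)
    convert this using 1
    module
  smul_mem' c v hv t := by
    rw [smul_smul]
    exact hv _

theorem mem_of_mem_lineality {v : X} (hv : v ∈ hK.lineality) : v ∈ K := by
  simpa using hv 1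

theorem add_mem_of_mem_lineality {v y : X} (hv : v ∈ hK.lineality) (hy : y ∈ K) : v + y ∈ K := by
  have := hK.two_smul_add_mem (hv (1 / 2)) hy
  convert this using 1
  module

/-- Otherwise points of `K` outside `V` tend to 0, and their projections along `V` to a complement
`W` are nonzero points of `K`. Their even multiples lie in `K` and become dense along a limiting
direction `u ∈ W`, so the whole line through `u` lies in `K`. This puts the unit vector `u` in `V ∩
W = 0`. -/
theorem exists_forall_norm_lt_mem_lineality [FiniteDimensional ℝ X] :
    ∃ ρ : ℝ, 0 < ρ ∧ ∀ x ∈ K, ‖x‖ < ρ → x ∈ hK.lineality := by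
  by_contra! hcon
  set V := hK.lineality
  have : ProperSpace X := FiniteDimensional.proper ℝ X
  obtain ⟨W, hVW⟩ := V.exists_isCompl
  choose x hxK hxn hxV using fun n : ℕ => hcon (1 / (n + 1)) Nat.one_div_pos_of_nat
  let P : X →ₗ[ℝ] X := W.projection V hVW.symm
  have hPc : Continuous P := P.continuous_of_finiteDimensional
  have hPW : ∀ y, P y ∈ W := fun y => W.projection_apply_mem hVW.symm y
  have hPV : ∀ y, y - P y ∈ V := fun y => Submodule.sub_projection_mem hVW.symm y
  have hPK : ∀ n, P (x n) ∈ K := by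
    intro n
    have := hK.add_mem_of_mem_lineality (V.neg_mem (hPV (x n))) (hxK n)
    simpa using this
  have hP0 : ∀ n, P (x n) ≠ 0 := by
    intro n h
    have := hPV (x n)
    rw [h, sub_zero] at this
    exact hxV n this
  have hx0 : Tendsto x atTop (𝓝 0) :=
    squeeze_zero_norm (fun n => (hxn n).le) tendsto_one_div_add_atTop_nhds_zero_nat
  have hPx0 : Tendsto (fun n => ‖P (x n)‖) atTop (𝓝 0) := by
    have := ((hPc.tendsto 0).comp hx0).norm
    simpa using this
  have hpos : ∀ n, 0 < ‖P (x n)‖ := fun n => norm_pos_iff.2 (hP0 n)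
  obtain ⟨u, hu, φ, hφ, hlim⟩ := (isCompact_sphere (0 : X) 1).tendsto_subseq
    (x := fun n => ‖P (x n)‖⁻¹ • P (x n)) (fun n => by
      rw [mem_sphere_zero_iff_norm, norm_smul, norm_inv, norm_norm, inv_mul_cancel₀ (hpos n).ne'])
  have huW : u ∈ W := by
    have hcl : IsClosed (W : Set X) := W.closed_of_finiteDimensional
    exact hcl.mem_of_tendsto hlim (Eventually.of_forall fun n => W.smul_mem _ (hPW _))
  have huV : u ∈ V := by
    intro t
    -- Rounding `t` down to a multiple of the step `2‖P x‖` has error at most one step, and the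
    -- steps tend to 0.
    have hk : Tendsto (fun n => (⌊t / (2 * ‖P (x (φ n))‖)⌋ : ℝ) * (2 * ‖P (x (φ n))‖)) atTop
        (𝓝 t) := by
      rw [tendsto_iff_dist_tendsto_zero]
      have h0 : Tendsto (fun n => 2 * ‖P (x (φ n))‖) atTop (𝓝 0) := by
        simpa using (hPx0.comp hφ.tendsto_atTop).const_mul 2
      refine squeeze_zero (fun _ => dist_nonneg) (fun n => ?_) h0
      have hp : 0 < 2 * ‖P (x (φ n))‖ := by have := hpos (φ n); positivity
      have h1 := Int.floor_le (t / (2 * ‖P (x (φ n))‖))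
      have h2 := Int.lt_floor_add_one (t / (2 * ‖P (x (φ n))‖))
      rw [le_div_iff₀ hp] at h1
      rw [div_lt_iff₀ hp] at h2
      rw [Real.dist_eq, abs_le]
      constructor <;> nlinarith
    refine hK.isClosed.mem_of_tendsto (hk.smul hlim) (Eventually.of_forall fun n => ?_)
    have := hK.int_smul_add_mem (hPK (φ n)) hK.zero_mem ⌊t / (2 * ‖P (x (φ n))‖)⌋
    convert this using 1
    have hne := (hpos (φ n)).ne'
    simp only [Function.comp_apply, add_zero, smul_smul]
    congr 1
    field_simp
  have hu0 : u = 0 := by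
    have : u ∈ V ⊓ W := ⟨huV, huW⟩
    rwa [hVW.inf_eq_bot, Submodule.mem_bot] at this
  rw [hu0] at hu
  simp at hu

end IsSymmetricClosed

end Symmetric

/-! ### Tools for comparing dimensions by counting -/

section Grid

variable {X : Type*} [NormedAddCommGroup X] [NormedSpace ℝ X]

theorem LinearIndependent.exists_norm_bounds {q : ℕ} {b : Fin q → X} (hb : LinearIndependent ℝ b) :
    ∃ c C : ℝ, 0 < c ∧ 0 < C ∧ ∀ v : Fin q → ℝ, c * ‖v‖ ≤ ‖∑ i, v i • b i‖ ∧
      ‖∑ i, v i • b i‖ ≤ C * ‖v‖ := by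
  let φ : (Fin q → ℝ) →ₗ[ℝ] X := Fintype.linearCombination ℝ b
  have hφ : ∀ v, φ v = ∑ i, v i • b i := fun v => Fintype.linearCombination_apply ℝ b v
  obtain ⟨κ, hκ, hanti⟩ := φ.exists_antilipschitzWith
    (LinearMap.ker_eq_bot.2 hb.fintypeLinearCombination_injective)
  let Φ : (Fin q → ℝ) →L[ℝ] X := φ.toContinuousLinearMap
  refine ⟨(κ : ℝ)⁻¹, ‖Φ‖ + 1, by positivity, by positivity, fun v => ⟨?_, ?_⟩⟩
  · have := hanti.le_mul_dist v 0
    rw [map_zero, dist_zero_right, dist_zero_right, hφ] at this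
    rwa [inv_mul_le_iff₀ (by positivity)]
  · rw [← hφ]
    refine (Φ.le_opNorm v).trans ?_
    gcongr
    linarith

theorem le_of_forall_pow_le_mul_pow {p m : ℕ} {C : ℝ}
    (h : ∀ N : ℕ, 0 < N → (N : ℝ) ^ p ≤ C * (N : ℝ) ^ m) : p ≤ m := by
  by_contra! hlt
  obtain ⟨N, hN⟩ := exists_nat_gt (max C 1)
  have hN1 : (1 : ℝ) < N := (le_max_right _ _).trans_lt hN
  have hNC : C < N := (le_max_left _ _).trans_lt hN
  have hN0 : 0 < N := by exact_mod_cast zero_lt_one.trans hN1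
  have h1 : (N : ℝ) ^ (m + 1) ≤ (N : ℝ) ^ p := pow_le_pow_right₀ hN1.le hlt
  have h2 : C * (N : ℝ) ^ m < (N : ℝ) ^ (m + 1) := by
    rw [pow_succ']
    gcongr
  linarith [h N hN0]

end Grid

/-! ### Rigidity of contents of unit density -/

/-- `lam` is a finitely additive set function that behaves like an `m`-dimensional measure of
density one on the closed set `K`. -/
structure IsUnitDensityContent {X : Type*} [NormedAddCommGroup X] [MeasurableSpace X] (m : ℕ)
    (K : Set X) (lam : Set X → ℝ≥0∞) : Prop where
  isClosed : IsClosed K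
  zero_mem : (0 : X) ∈ K
  mono : Monotone lam
  union_add_inter : ∀ s t : Set X, MeasurableSet t → lam (s ∪ t) + lam (s ∩ t) = lam s + lam t
  null : ∀ C : Set X, IsCompact C → C ∩ K = ∅ → lam C = 0
  upper : ∀ C : Set X, IsCompact C → lam C ≤ ENNReal.ofReal (diam (C ∩ K) ^ m)
  lower : ∀ x ∈ K, ∀ r : ℝ, 0 < r → ENNReal.ofReal ((2 * r) ^ m) ≤ lam (ball x r)

namespace IsUnitDensityContent

variable {X : Type*} [NormedAddCommGroup X] [MeasurableSpace X] {m : ℕ} {K : Set X}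
  {lam : Set X → ℝ≥0∞} (h : IsUnitDensityContent m K lam)
include h

theorem empty_eq_zero : lam ∅ = 0 := h.null ∅ isCompact_empty (empty_inter _)

theorem union_le (s : Set X) {t : Set X} (ht : MeasurableSet t) :
    lam (s ∪ t) ≤ lam s + lam t := by
  rw [← h.union_add_inter s t ht]
  exact le_self_add

theorem union_of_disjoint {s t : Set X} (ht : MeasurableSet t) (hst : Disjoint s t) :
    lam (s ∪ t) = lam s + lam t := by
  rw [← h.union_add_inter s t ht, hst.inter_eq, h.empty_eq_zero, add_zero]

variable [OpensMeasurableSpace X]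

theorem biUnion_ball_le {ι : Type*} (S : Finset ι) (f : ι → X) (r : ℝ) :
    lam (⋃ i ∈ S, ball (f i) r) ≤ ∑ i ∈ S, lam (ball (f i) r) := by
  classical
  induction S using Finset.induction_on with
  | empty => simp [h.empty_eq_zero]
  | insert a S ha ih =>
    rw [Finset.set_biUnion_insert, Finset.sum_insert ha, union_comm, add_comm]
    exact (h.union_le _ measurableSet_ball).trans (by gcongr)

theorem biUnion_ball_eq {ι : Type*} (S : Finset ι) (f : ι → X) (r : ℝ)
    (hd : (S : Set ι).PairwiseDisjoint fun i => ball (f i) r) :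
    lam (⋃ i ∈ S, ball (f i) r) = ∑ i ∈ S, lam (ball (f i) r) := by
  classical
  induction S using Finset.induction_on with
  | empty => simp [h.empty_eq_zero]
  | insert a S ha ih =>
    rw [Finset.coe_insert, pairwiseDisjoint_insert_of_notMem (by simpa using ha)] at hd
    rw [Finset.set_biUnion_insert, Finset.sum_insert ha, union_comm, add_comm,
      h.union_of_disjoint measurableSet_ball, ih hd.1]
    simp only [disjoint_iUnion_left]
    exact fun i hi => (hd.2 i hi).symm

variable [NormedSpace ℝ X] [FiniteDimensional ℝ X]

/-- Packing: disjoint balls of radius `s` about points of `K` weigh at least `(2s)^m` each, and all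
lie in one ball of radius `t + s`. -/
theorem card_mul_le_of_separated {ι : Type*} (S : Finset ι) (f : ι → X) {s t : ℝ} (hs : 0 < s)
    (ht : 0 ≤ t) (hf : ∀ i ∈ S, f i ∈ K) (hft : ∀ i ∈ S, ‖f i‖ ≤ t)
    (hsep : ∀ i ∈ S, ∀ j ∈ S, i ≠ j → 2 * s ≤ dist (f i) (f j)) :
    (S.card : ℝ) * (2 * s) ^ m ≤ (2 * (t + s)) ^ m := by
  have : ProperSpace X := FiniteDimensional.proper ℝ X
  have h1 : ENNReal.ofReal (S.card * (2 * s) ^ m) ≤ ENNReal.ofReal ((2 * (t + s)) ^ m) := by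
    calc ENNReal.ofReal (S.card * (2 * s) ^ m) = ∑ i ∈ S, ENNReal.ofReal ((2 * s) ^ m) := by
          rw [Finset.sum_const, nsmul_eq_mul, ENNReal.ofReal_mul (by positivity),
            ENNReal.ofReal_natCast]
      _ ≤ ∑ i ∈ S, lam (ball (f i) s) :=
          Finset.sum_le_sum fun i hi => h.lower _ (hf i hi) s hs
      _ = lam (⋃ i ∈ S, ball (f i) s) := by
          refine (h.biUnion_ball_eq S f s fun i hi j hj hij => ?_).symm
          exact ball_disjoint_ball (by have := hsep i hi j hj hij; linarith)
      _ ≤ lam (closedBall 0 (t + s)) := by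
          refine h.mono (iUnion₂_subset fun i hi => ?_)
          refine ball_subset_closedBall.trans (closedBall_subset_closedBall' ?_)
          rw [dist_zero_right]
          linarith [hft i hi]
      _ ≤ ENNReal.ofReal (diam (closedBall 0 (t + s) ∩ K) ^ m) :=
          h.upper _ (isCompact_closedBall _ _)
      _ ≤ _ := by
          gcongr
          exact (diam_mono inter_subset_left isBounded_closedBall).trans
            (diam_closedBall (by positivity))
  exact (ENNReal.ofReal_le_ofReal_iff (by positivity)).1 h1

/-- Covering: the part of the large ball outside the small ones misses `K` and so weighs nothing. -/
theorem le_card_mul_of_cover {ι : Type*} (S : Finset ι) (f : ι → X) {s t : ℝ} (hs : 0 < s)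
    (ht : 0 < t) (hcov : closedBall 0 t ∩ K ⊆ ⋃ i ∈ S, ball (f i) s) :
    (2 * t) ^ m ≤ (S.card : ℝ) * (2 * s) ^ m := by
  have : ProperSpace X := FiniteDimensional.proper ℝ X
  have hopen : IsOpen (⋃ i ∈ S, ball (f i) s) := isOpen_biUnion fun i _ => isOpen_ball
  have h1 : ENNReal.ofReal ((2 * t) ^ m) ≤ ENNReal.ofReal (S.card * (2 * s) ^ m) := by
    calc ENNReal.ofReal ((2 * t) ^ m) ≤ lam (ball 0 t) := h.lower 0 h.zero_mem t ht
      _ ≤ lam (closedBall 0 t \ (⋃ i ∈ S, ball (f i) s) ∪ ⋃ i ∈ S, ball (f i) s) := by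
          refine h.mono (ball_subset_closedBall.trans ?_)
          rw [sdiff_union_self]
          exact subset_union_left
      _ ≤ lam (closedBall 0 t \ (⋃ i ∈ S, ball (f i) s)) + lam (⋃ i ∈ S, ball (f i) s) :=
          h.union_le _ hopen.measurableSet
      _ = lam (⋃ i ∈ S, ball (f i) s) := by
          rw [h.null _ ((isCompact_closedBall _ _).diff hopen), zero_add]
          ext x
          simp only [mem_inter_iff, Set.mem_sdiff, mem_empty_iff_false, iff_false]
          rintro ⟨⟨hx1, hx2⟩, hx3⟩
          exact hx2 (hcov ⟨hx1, hx3⟩)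
      _ ≤ ∑ i ∈ S, lam (ball (f i) s) := h.biUnion_ball_le S f s
      _ ≤ ∑ i ∈ S, ENNReal.ofReal ((2 * s) ^ m) := by
          refine Finset.sum_le_sum fun i _ => (h.mono ball_subset_closedBall).trans
            ((h.upper _ (isCompact_closedBall _ _)).trans ?_)
          gcongr
          exact (diam_mono inter_subset_left isBounded_closedBall).trans
            (diam_closedBall hs.le)
      _ = _ := by
          rw [Finset.sum_const, nsmul_eq_mul, ENNReal.ofReal_mul (by positivity),
            ENNReal.ofReal_natCast]
  exact (ENNReal.ofReal_le_ofReal_iff (by positivity)).1 h1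

/-- An approximate reflection of `y` in `x`, found by comparing the mass of `B(x, ρ) ∪ B(y, δ)` with
that of the overlap. -/
theorem exists_mem_closedBall_far [StrictConvexSpace ℝ X] (hm : m ≠ 0) {x y : X} (hx : x ∈ K)
    (hy : y ∈ K) {δ : ℝ} (hδ : 0 < δ) (hδρ : δ ≤ dist x y) :
    ∃ q ∈ closedBall x (dist x y) ∩ K, 2 * dist x y - δ ≤ dist q y := by
  have : ProperSpace X := FiniteDimensional.proper ℝ X
  set ρ := dist x y with hρ
  have hρ0 : 0 < ρ := hδ.trans_le hδρ
  have hsmall : diam (closedBall x ρ ∩ closedBall y δ) < 2 * δ := by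
    have hC : IsCompact (closedBall x ρ ∩ closedBall y δ) :=
      (isCompact_closedBall _ _).inter (isCompact_closedBall _ _)
    have hne : (closedBall x ρ ∩ closedBall y δ).Nonempty :=
      ⟨y, by rw [mem_closedBall, dist_comm], mem_closedBall_self hδ.le⟩
    obtain ⟨⟨p, q⟩, hpq, hmax⟩ := (hC.prod hC).exists_isMaxOn (hne.prod hne)
      (f := fun z : X × X => dist z.1 z.2) continuous_dist.continuousOn
    have hle : diam (closedBall x ρ ∩ closedBall y δ) ≤ dist p q :=
      diam_le_of_forall_dist_le dist_nonneg fun a ha b hb => hmax (mk_mem_prod ha hb)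
    -- If the diameter `dist p q` reached `2δ`, then `y` would be the midpoint of `p` and `q`;
    -- strict convexity would place it in the open ball about `x`, although it lies on the sphere.
    refine hle.trans_lt ?_
    by_contra! hge
    obtain ⟨⟨hp1, hp2⟩, hq1, hq2⟩ := hpq
    rw [mem_closedBall] at hp2 hq2
    have htri := dist_triangle_right p q y
    have e1 : dist p y = dist p q / 2 := by dsimp only at *; linarith
    have e2 : dist y q = dist p q / 2 := by rw [dist_comm]; dsimp only at *; linarith
    have hmid := eq_midpoint_of_dist_eq_half e1 e2
    have hpq : p ≠ q := by
      rintro rfl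
      rw [dist_self] at hge
      linarith
    have hin := combo_mem_ball_of_ne hp1 hq1 hpq (a := 1 / 2) (b := 1 / 2) (by norm_num)
      (by norm_num) (by norm_num)
    have : (1 / 2 : ℝ) • p + (1 / 2 : ℝ) • q = y := by
      rw [hmid, midpoint_eq_smul_add, invOf_eq_inv]
      module
    rw [this, mem_ball, dist_comm] at hin
    exact lt_irrefl _ hin
  have hbig : 2 * ρ < diam ((closedBall x ρ ∪ closedBall y δ) ∩ K) := by
    have h1 : ENNReal.ofReal ((2 * ρ) ^ m) + ENNReal.ofReal ((2 * δ) ^ m) ≤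
        ENNReal.ofReal (diam ((closedBall x ρ ∪ closedBall y δ) ∩ K) ^ m) +
        ENNReal.ofReal (diam (closedBall x ρ ∩ closedBall y δ) ^ m) := by
      calc _ ≤ lam (closedBall x ρ) + lam (closedBall y δ) :=
            add_le_add ((h.lower x hx ρ hρ0).trans (h.mono ball_subset_closedBall))
              ((h.lower y hy δ hδ).trans (h.mono ball_subset_closedBall))
        _ = lam (closedBall x ρ ∪ closedBall y δ) + lam (closedBall x ρ ∩ closedBall y δ) :=
            (h.union_add_inter _ _ measurableSet_closedBall).symm
        _ ≤ _ := by
            refine add_le_add (h.upper _ ((isCompact_closedBall _ _).union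
              (isCompact_closedBall _ _))) ((h.upper _ ((isCompact_closedBall _ _).inter
              (isCompact_closedBall _ _))).trans ?_)
            gcongr ENNReal.ofReal (?_ ^ m)
            exact diam_mono inter_subset_left (isBounded_closedBall.subset inter_subset_left)
    rw [← ENNReal.ofReal_add (by positivity) (by positivity),
      ← ENNReal.ofReal_add (by positivity) (by positivity),
      ENNReal.ofReal_le_ofReal_iff (by positivity)] at h1
    have h2 : diam (closedBall x ρ ∩ closedBall y δ) ^ m < (2 * δ) ^ m :=
      pow_lt_pow_left₀ hsmall diam_nonneg hm
    exact lt_of_pow_lt_pow_left₀ m diam_nonneg (by linarith)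
  obtain ⟨p, hp, q, hq, hpq⟩ : ∃ p ∈ (closedBall x ρ ∪ closedBall y δ) ∩ K,
      ∃ q ∈ (closedBall x ρ ∪ closedBall y δ) ∩ K, 2 * ρ < dist p q := by
    by_contra! hcon
    exact absurd (diam_le_of_forall_dist_le (by positivity) hcon) (not_le.2 hbig)
  -- Points more than `2ρ` apart cannot both lie in `B(x, ρ)`, nor both in `B(y, δ)` as `δ ≤ ρ`; so
  -- each ball contains one of them.
  have aux : ∀ p ∈ closedBall y δ, ∀ q ∈ (closedBall x ρ ∪ closedBall y δ) ∩ K, 2 * ρ < dist p q →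
      ∃ q ∈ closedBall x ρ ∩ K, 2 * ρ - δ ≤ dist q y := by
    rintro p hp q ⟨hq | hq, hqK⟩ hpq
    · refine ⟨q, ⟨hq, hqK⟩, ?_⟩
      rw [mem_closedBall] at hp
      have := dist_triangle p y q
      rw [dist_comm y q] at this
      linarith
    · rw [mem_closedBall] at hp hq
      have := dist_triangle_right p q y
      linarith
  rcases hp.1 with hp1 | hp1
  · rcases hq.1 with hq1 | hq1
    · rw [mem_closedBall] at hp1 hq1
      have := dist_triangle_right p q x
      linarith
    · exact aux q hq1 p hp (by rwa [dist_comm])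
  · exact aux p hp1 q hq hpq

/-- As `δ → 0`, compactness gives `q ∈ K` with `dist q x ≤ ρ` and `dist q y ≥ 2ρ`; strict convexity
then makes `x` the midpoint of `q` and `y`. -/
theorem isSymmetricClosed [StrictConvexSpace ℝ X] : IsSymmetricClosed K := by
  have : ProperSpace X := FiniteDimensional.proper ℝ X
  refine ⟨h.isClosed, h.zero_mem, fun x hx y hy => ?_⟩
  rcases eq_or_ne x y with rfl | hxy
  · convert hx using 1
    module
  have hρ0 : 0 < dist x y := dist_pos.2 hxy
  -- For `m = 0` two disjoint balls would weigh at least 1 each inside a ball of weight at most 1,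
  -- so `K` has only one point.
  rcases eq_or_ne m 0 with rfl | hm
  · exfalso
    have h1 := h.card_mul_le_of_separated (Finset.univ : Finset Bool) (fun i => if i then x else y)
      (s := dist x y / 2) (t := max ‖x‖ ‖y‖) (by positivity) (by positivity)
      (by intro i _; cases i <;> simp [hx, hy]) (by intro i _; cases i <;> simp)
      (by
        intro i _ j _ hij
        cases i <;> cases j <;> simp_all [dist_comm] <;> linarith)
    norm_num at h1
  · have hC : IsCompact (closedBall x (dist x y) ∩ K) :=
      (isCompact_closedBall _ _).inter_right h.isClosed
    obtain ⟨q, hq, hmax⟩ := hC.exists_isMaxOn (f := fun q => dist q y)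
      ⟨y, by rw [mem_closedBall, dist_comm], hy⟩ (by fun_prop)
    have hfar : 2 * dist x y ≤ dist q y := by
      refine le_of_forall_pos_le_add fun δ hδ => ?_
      obtain ⟨q', hq', hle⟩ := h.exists_mem_closedBall_far hm hx hy (lt_min hδ hρ0)
        (min_le_right _ _)
      have h1 : dist q' y ≤ dist q y := hmax hq'
      have h2 := min_le_left δ (dist x y)
      linarith
    have hqx : dist q x ≤ dist x y := hq.1
    have htri := dist_triangle q x y
    have hmid := eq_midpoint_of_dist_eq_half (x := q) (y := x) (z := y) (by linarith)
      (by linarith)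
    convert hq.2 using 1
    rw [hmid, midpoint_eq_smul_add, invOf_eq_inv]
    module

/-- The `N^q` grid points with coefficients below `N` are separated by `c` and lie within `C N` of
0, so packing gives `N^q ≤ const · N^m`. -/
theorem le_of_grid_subset {q : ℕ} {b : Fin q → X} (hb : LinearIndependent ℝ b)
    (hK : ∀ k : Fin q → ℕ, ∑ i, (k i : ℝ) • b i ∈ K) : q ≤ m := by
  obtain ⟨c, C, hc, hC, hbd⟩ := hb.exists_norm_bounds
  refine le_of_forall_pow_le_mul_pow (C := (2 * (C + c / 2)) ^ m / c ^ m) fun N hN => ?_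
  have hN1 : (1 : ℝ) ≤ N := by exact_mod_cast hN
  have h1 := h.card_mul_le_of_separated (Finset.univ : Finset (Fin q → Fin N))
    (fun k => ∑ i, (((k i : ℕ) : ℝ)) • b i) (s := c / 2) (t := C * N) (by positivity)
    (by positivity) (fun k _ => hK fun i => (k i : ℕ))
    (fun k _ => by
      refine (hbd fun i => ((k i : ℕ) : ℝ)).2.trans ?_
      gcongr
      refine (pi_norm_le_iff_of_nonneg (by positivity)).2 fun i => ?_
      rw [Real.norm_natCast]
      exact_mod_cast (k i).2.le)
    (fun k _ l _ hkl => by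
      rw [dist_eq_norm, ← Finset.sum_sub_distrib]
      simp_rw [← sub_smul]
      have h2 := (hbd fun i => ((k i : ℕ) : ℝ) - ((l i : ℕ) : ℝ)).1
      refine le_trans ?_ h2
      have h3 : 1 ≤ ‖fun i => ((k i : ℕ) : ℝ) - ((l i : ℕ) : ℝ)‖ := by
        obtain ⟨i, hi⟩ := Function.ne_iff.1 hkl
        refine le_trans ?_ (norm_le_pi_norm _ i)
        have h4 : ((k i : ℕ) : ℤ) - ((l i : ℕ) : ℤ) ≠ 0 := by
          intro h0
          exact hi (Fin.ext (by omega))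
        have h5 := Int.one_le_abs h4
        rw [Real.norm_eq_abs]
        exact_mod_cast h5
      nlinarith)
  rw [div_mul_eq_mul_div, le_div_iff₀ (by positivity), ← mul_pow]
  simp only [Finset.card_univ, Fintype.card_pi, Fintype.card_fin, Finset.prod_const,
    Nat.cast_pow] at h1
  calc (N : ℝ) ^ q * c ^ m = (N : ℝ) ^ q * (2 * (c / 2)) ^ m := by ring_nf
    _ ≤ _ := h1
    _ ≤ _ := pow_le_pow_left₀ (by positivity) (by nlinarith) m

/-- Near 0, `K` is covered by `(2N + 1)^p` balls of radius `2C/N` with `p = dim V`; the covering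
bound yields `N^m ≤ const · N^p`. -/
theorem le_of_subset_submodule {V : Submodule ℝ X} {ρ : ℝ} (hρ : 0 < ρ)
    (hV : ∀ x ∈ K, ‖x‖ < ρ → x ∈ V) : m ≤ Module.finrank ℝ V := by
  set p := Module.finrank ℝ V with hp
  let b := Module.finBasis ℝ V
  have hb : LinearIndependent ℝ fun i => (b i : X) :=
    b.linearIndependent.map' V.subtype (Submodule.ker_subtype V)
  obtain ⟨c, C, hc, hC, hbd⟩ := hb.exists_norm_bounds
  -- `t < ρ` keeps the ball where `K` lies in `V`; `t ≤ c` keeps coordinates in `[-1, 1]`.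
  set t := min (ρ / 2) c with ht
  have ht0 : 0 < t := by positivity
  refine le_of_forall_pow_le_mul_pow (C := 3 ^ p * (4 * C) ^ m / (2 * t) ^ m) fun N hN => ?_
  have hN0 : (0 : ℝ) < N := by exact_mod_cast hN
  have hN1 : (1 : ℝ) ≤ N := by exact_mod_cast hN
  -- Rounding coordinates to multiples of `1/N` moves a point by at most `C/N`; the radius is
  -- doubled for strict inequality.
  have h1 := h.le_card_mul_of_cover (Finset.univ : Finset (Fin p → Fin (2 * N + 1)))
    (fun k => ∑ i, ((((k i : ℕ) : ℝ) - N) / N) • (b i : X)) (s := 2 * C / N) (t := t)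
    (by positivity) ht0 (by
      rintro x ⟨hxt, hxK⟩
      rw [mem_closedBall, dist_zero_right] at hxt
      have hxV : x ∈ V := hV x hxK (by linarith [min_le_left (ρ / 2) c])
      set v : Fin p → ℝ := fun i => b.repr ⟨x, hxV⟩ i with hv
      have hxv : x = ∑ i, v i • (b i : X) := by
        have := congrArg V.subtype (b.sum_repr ⟨x, hxV⟩)
        rw [_root_.map_sum] at this
        simp only [map_smul, Submodule.subtype_apply] at this
        exact this.symm
      have hv1 : ‖v‖ ≤ 1 := by
        have h2 := (hbd v).1
        rw [← hxv] at h2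
        have h3 : c * ‖v‖ ≤ c * 1 := by linarith [min_le_right (ρ / 2) c]
        exact le_of_mul_le_mul_left h3 hc
      have hvi : ∀ i, -1 ≤ v i ∧ v i ≤ 1 := fun i =>
        abs_le.1 ((norm_le_pi_norm v i).trans hv1)
      have hk0 : ∀ i, 0 ≤ (v i + 1) * N := fun i =>
        mul_nonneg (by linarith [(hvi i).1]) hN0.le
      have hk : ∀ i, ⌊(v i + 1) * N⌋₊ < 2 * N + 1 := by
        intro i
        rw [Nat.lt_succ_iff]
        refine Nat.floor_le_of_le ?_
        push_cast
        nlinarith [(hvi i).2]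
      refine mem_biUnion (x := fun i => ⟨⌊(v i + 1) * N⌋₊, hk i⟩) (Finset.mem_coe.2 (Finset.mem_univ _)) ?_
      rw [mem_ball, dist_eq_norm, hxv, ← Finset.sum_sub_distrib]
      simp_rw [← sub_smul]
      refine ((hbd fun i => v i - ((⌊(v i + 1) * N⌋₊ : ℝ) - N) / N).2).trans_lt ?_
      have h5 : ‖fun i => v i - ((⌊(v i + 1) * N⌋₊ : ℝ) - N) / N‖ ≤ 1 / N := by
        refine (pi_norm_le_iff_of_nonneg (by positivity)).2 fun i => ?_
        have h6 := Nat.floor_le (hk0 i)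
        have h7 := Nat.lt_floor_add_one ((v i + 1) * N)
        have h8 : v i - ((⌊(v i + 1) * N⌋₊ : ℝ) - N) / N =
            ((v i + 1) * N - ⌊(v i + 1) * N⌋₊) / N := by
          field_simp
          ring
        rw [h8, Real.norm_eq_abs, abs_div, abs_of_pos hN0]
        gcongr
        rw [abs_le]
        constructor <;> linarith
      calc _ ≤ C * (1 / N) := by gcongr
        _ = C / N := by ring
        _ < 2 * C / N := by gcongr; linarith)
  simp only [Finset.card_univ, Fintype.card_pi, Fintype.card_fin, Finset.prod_const,
    Nat.cast_pow] at h1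
  rw [div_mul_eq_mul_div, le_div_iff₀ (by positivity)]
  have h2 : (2 * (2 * C / N) : ℝ) ^ m = (4 * C) ^ m / (N : ℝ) ^ m := by
    rw [← div_pow]
    ring_nf
  rw [h2, mul_div_assoc', le_div_iff₀ (by positivity)] at h1
  calc (N : ℝ) ^ m * (2 * t) ^ m = (2 * t) ^ m * (N : ℝ) ^ m := mul_comm _ _
    _ ≤ _ := h1
    _ ≤ (3 * N : ℝ) ^ p * (4 * C) ^ m := by
      gcongr
      push_cast
      linarith
    _ = _ := by rw [mul_pow]; ring

/-- A closed set carrying a finitely additive content of unit density is an `m`-plane. -/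
theorem exists_submodule_eq [StrictConvexSpace ℝ X] :
    ∃ V : Submodule ℝ X, Module.finrank ℝ V = m ∧ K = (V : Set X) := by
  have hK := h.isSymmetricClosed
  obtain ⟨ρ, hρ, hloc⟩ := hK.exists_forall_norm_lt_mem_lineality
  set V := hK.lineality
  have hge : m ≤ Module.finrank ℝ V := h.le_of_subset_submodule hρ hloc
  let b := Module.finBasis ℝ V
  have hb : LinearIndependent ℝ fun i => (b i : X) :=
    b.linearIndependent.map' V.subtype (Submodule.ker_subtype V)
  have hbV : ∀ k : Fin (Module.finrank ℝ V) → ℕ, ∑ i, (k i : ℝ) • (b i : X) ∈ V := fun k =>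
    V.sum_mem fun i _ => V.smul_mem _ (b i).2
  have hle : Module.finrank ℝ V ≤ m :=
    h.le_of_grid_subset hb fun k => hK.mem_of_mem_lineality (hbV k)
  refine ⟨V, le_antisymm hle hge, Subset.antisymm (fun w hw => ?_)
    fun v hv => hK.mem_of_mem_lineality hv⟩
  by_contra hwV
  have hspan : Submodule.span ℝ (range fun i => (b i : X)) ≤ V :=
    Submodule.span_le.2 (range_subset_iff.2 fun i => (b i).2)
  -- Translations by `2w` preserve `K`, so a point `w` of `K` outside `V` would give a grid of rank
  -- `m + 1` in `K`, against packing.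
  have hb' : LinearIndependent ℝ (Fin.cons ((2 : ℝ) • w) fun i => (b i : X)) := by
    refine linearIndependent_finCons.2 ⟨hb, fun hw2 => hwV ?_⟩
    have := V.smul_mem (1 / 2) (hspan hw2)
    simpa [smul_smul] using this
  have hle' := h.le_of_grid_subset hb' fun k => by
    rw [Fin.sum_univ_succ]
    simp only [Fin.cons_zero, Fin.cons_succ]
    exact hK.nat_smul_add_mem hw (hK.mem_of_mem_lineality (hbV fun i => k i.succ)) _
  omega

end IsUnitDensityContent

/-! ### Ultralimits of sets and of measures -/

section Ultralimit

variable {X ι : Type*} [MetricSpace X]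

/-- The limit of a family of sets along an ultrafilter. -/
def ultralimitSet (u : Ultrafilter ι) (G : ι → Set X) : Set X :=
  {x | ∀ ρ : ℝ, 0 < ρ → ∀ᶠ n in (u : Filter ι), (ball x ρ ∩ G n).Nonempty}

theorem isClosed_ultralimitSet (u : Ultrafilter ι) (G : ι → Set X) :
    IsClosed (ultralimitSet u G) := by
  refine isClosed_of_closure_subset fun x hx ρ hρ => ?_
  obtain ⟨y, hy, hxy⟩ := Metric.mem_closure_iff.1 hx (ρ / 2) (by positivity)
  filter_upwards [hy (ρ / 2) (by positivity)] with n hn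
  refine hn.mono (inter_subset_inter_left _ (ball_subset_ball' ?_))
  rw [dist_comm]
  linarith

theorem IsCompact.exists_tendsto_ultrafilter {Y : Type*} [TopologicalSpace Y] {C : Set Y}
    (hC : IsCompact C) (u : Ultrafilter ι) {x : ι → Y} (hx : ∀ᶠ n in (u : Filter ι), x n ∈ C) :
    ∃ y ∈ C, Tendsto x u (𝓝 y) :=
  hC.ultrafilter_le_nhds' (u.map x) hx

theorem exists_tendsto_mem_ultralimitSet {u : Ultrafilter ι} {G : ι → Set X} {C : Set X}
    (hC : IsCompact C) {x : ι → X} (hx : ∀ᶠ n in (u : Filter ι), x n ∈ C ∩ G n) :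
    ∃ y ∈ C ∩ ultralimitSet u G, Tendsto x u (𝓝 y) := by
  obtain ⟨y, hyC, hy⟩ := hC.exists_tendsto_ultrafilter u (hx.mono fun n h => h.1)
  refine ⟨y, ⟨hyC, fun ρ hρ => ?_⟩, hy⟩
  filter_upwards [hx, hy.eventually (ball_mem_nhds y hρ)] with n h1 h2
  exact ⟨x n, h2, h1.2⟩

theorem eventually_inter_eq_empty {u : Ultrafilter ι} {G : ι → Set X} {C : Set X}
    (hC : IsCompact C) (hCG : C ∩ ultralimitSet u G = ∅) :
    ∀ᶠ n in (u : Filter ι), C ∩ G n = ∅ := by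
  by_contra hcon
  rw [← Ultrafilter.eventually_not] at hcon
  have h1 : ∃ x : ι → X, ∀ᶠ n in (u : Filter ι), x n ∈ C ∩ G n := by
    obtain ⟨n₀, hn₀⟩ := hcon.exists
    have : Nonempty X := ⟨(nonempty_iff_ne_empty.2 hn₀).some⟩
    have h2 : ∀ n, ∃ x : X, ¬ C ∩ G n = ∅ → x ∈ C ∩ G n := fun n => by
      by_cases h : C ∩ G n = ∅
      · exact ⟨Classical.arbitrary X, fun h' => absurd h h'⟩
      · exact ⟨(nonempty_iff_ne_empty.2 h).some, fun _ => (nonempty_iff_ne_empty.2 h).some_mem⟩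
    choose x hx using h2
    exact ⟨x, hcon.mono hx⟩
  obtain ⟨x, hx⟩ := h1
  obtain ⟨y, hy, -⟩ := exists_tendsto_mem_ultralimitSet hC hx
  rw [hCG] at hy
  exact hy

/-- Otherwise pairs in `C ∩ G n` at distance at least `D + ε` converge to a pair in the limit set,
whose intersection with `C` has diameter only `D`. -/
theorem eventually_ediam_le {u : Ultrafilter ι} {G : ι → Set X} {C : Set X}
    (hC : IsCompact C) {ε : ℝ} (hε : 0 < ε) :
    ∀ᶠ n in (u : Filter ι), ediam (C ∩ G n) ≤ ENNReal.ofReal (diam (C ∩ ultralimitSet u G) + ε) := by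
  by_contra hcon
  rw [← Ultrafilter.eventually_not] at hcon
  set D := diam (C ∩ ultralimitSet u G) with hD
  have h2 : ∀ n, ∃ x : X × X, ¬ ediam (C ∩ G n) ≤ ENNReal.ofReal (D + ε) →
      x.1 ∈ C ∩ G n ∧ x.2 ∈ C ∩ G n ∧ D + ε ≤ dist x.1 x.2 := by
    intro n
    have h3 : ∀ n, ¬ ediam (C ∩ G n) ≤ ENNReal.ofReal (D + ε) → ∃ x : X × X,
        x.1 ∈ C ∩ G n ∧ x.2 ∈ C ∩ G n ∧ D + ε ≤ dist x.1 x.2 := by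
      intro n hn
      by_contra! h4
      refine hn (ediam_le fun a ha b hb => ?_)
      rw [edist_dist]
      exact ENNReal.ofReal_le_ofReal (h4 (a, b) ha hb).le
    by_cases h : ediam (C ∩ G n) ≤ ENNReal.ofReal (D + ε)
    · obtain ⟨n₀, hn₀⟩ := hcon.exists
      obtain ⟨x, -⟩ := h3 n₀ hn₀
      exact ⟨x, fun h' => absurd h h'⟩
    · obtain ⟨x, hx⟩ := h3 n h
      exact ⟨x, fun _ => hx⟩
  choose x hx using h2
  have hx' := hcon.mono hx
  obtain ⟨y, hy, hylim⟩ := exists_tendsto_mem_ultralimitSet (u := u) (G := G) hC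
    (x := fun n => (x n).1) (hx'.mono fun n h => h.1)
  obtain ⟨z, hz, hzlim⟩ := exists_tendsto_mem_ultralimitSet (u := u) (G := G) hC
    (x := fun n => (x n).2) (hx'.mono fun n h => h.2.1)
  have h5 : D + ε ≤ dist y z := ge_of_tendsto (hylim.dist hzlim) (hx'.mono fun n h => h.2.2)
  have h6 : dist y z ≤ D := dist_le_diam_of_mem (hC.isBounded.subset inter_subset_left) hy hz
  linarith

end Ultralimit

/-- The ultralimit of measures with asymptotically unit density on sets `G n` that asymptotically
carry all the mass is a content of unit density on the ultralimit of the sets. -/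
theorem exists_isUnitDensityContent {X ι : Type*} [NormedAddCommGroup X] [NormedSpace ℝ X]
    [FiniteDimensional ℝ X] [MeasurableSpace X] [BorelSpace X] {m : ℕ} (u : Ultrafilter ι)
    (G : ι → Set X) (ν : ι → Measure X) (h0 : ∀ n, (0 : X) ∈ G n)
    (hup : ∀ ε R : ℝ, 0 < ε → 0 < R → ∀ᶠ n in (u : Filter ι), ∀ S : Set X, MeasurableSet S →
      (S ∩ G n).Nonempty → ediam S < ENNReal.ofReal R →
      ν n S ≤ ENNReal.ofReal (1 + ε) * ediam S ^ m)
    (hlow : ∀ ε R : ℝ, 0 < ε → 0 < R → ∀ᶠ n in (u : Filter ι), ∀ x ∈ G n, ∀ r : ℝ, 0 < r → r < R →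
      ENNReal.ofReal ((1 - ε) * (2 * r) ^ m) ≤ ν n (ball x r))
    (hfull : ∀ ε R : ℝ, 0 < ε → 0 < R → ∀ᶠ n in (u : Filter ι), ∀ C : Set X, MeasurableSet C →
      C ⊆ ball 0 R → ν n C ≤ ν n (closure (C ∩ G n)) + ENNReal.ofReal ε) :
    ∃ lam, IsUnitDensityContent m (ultralimitSet u G) lam := by
  have : ProperSpace X := FiniteDimensional.proper ℝ X
  -- Compactness of `[0, ∞]` gives a limit for every set at once; only finite additivity survives.
  have hex : ∀ S : Set X, ∃ l : ℝ≥0∞, Tendsto (fun n => ν n S) u (𝓝 l) := fun S => by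
    obtain ⟨l, -, hl⟩ := isCompact_univ.exists_tendsto_ultrafilter u (x := fun n => ν n S)
      (Eventually.of_forall fun _ => mem_univ _)
    exact ⟨l, hl⟩
  choose lam hlam using hex
  have hball : ∀ C : Set X, IsCompact C → ∃ R : ℝ, 0 < R ∧ C ⊆ ball 0 R := fun C hC => by
    obtain ⟨R, hR⟩ := hC.isBounded.subset_ball 0
    exact ⟨max R 1, by positivity, hR.trans (ball_subset_ball (le_max_left _ _))⟩
  have hpos : ∀ᶠ ε : ℝ in 𝓝[>] 0, 0 < ε := self_mem_nhdsWithin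
  refine ⟨lam, isClosed_ultralimitSet u G, ?_, ?_, ?_, ?_, ?_, ?_⟩
  · exact fun ρ hρ => Eventually.of_forall fun n => ⟨0, mem_ball_self hρ, h0 n⟩
  · exact fun s t hst => le_of_tendsto_of_tendsto' (hlam s) (hlam t) fun n => measure_mono hst
  · intro s t ht
    refine tendsto_nhds_unique ((hlam (s ∪ t)).add (hlam (s ∩ t))) ?_
    exact ((hlam s).add (hlam t)).congr fun n => (measure_union_add_inter s ht).symm
  · intro C hC hCK
    obtain ⟨R, hR, hCR⟩ := hball C hC
    have hlim : Tendsto ENNReal.ofReal (𝓝[>] 0) (𝓝 0) := by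
      have := (ENNReal.continuous_ofReal.tendsto 0).mono_left (nhdsWithin_le_nhds (s := Ioi 0))
      simpa using this
    refine le_antisymm (ge_of_tendsto hlim ?_) zero_le
    filter_upwards [hpos] with ε hε
    refine le_of_tendsto (hlam C) ?_
    filter_upwards [eventually_inter_eq_empty hC hCK, hfull ε R hε hR] with n h1 h2
    simpa [h1] using h2 C hC.measurableSet hCR
  · intro C hC
    obtain ⟨R, hR, hCR⟩ := hball C hC
    set D := diam (C ∩ ultralimitSet u G) with hD
    have hD0 : 0 ≤ D := diam_nonneg
    have hlim : Tendsto (fun ε : ℝ => ENNReal.ofReal ((1 + ε) * (D + ε) ^ m + ε)) (𝓝[>] 0)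
        (𝓝 (ENNReal.ofReal ((1 + 0) * (D + 0) ^ m + 0))) :=
      Tendsto.mono_left ((ENNReal.continuous_ofReal.comp
        (by fun_prop : Continuous fun ε : ℝ => (1 + ε) * (D + ε) ^ m + ε)).tendsto 0)
        nhdsWithin_le_nhds
    simp only [add_zero, one_mul] at hlim
    refine ge_of_tendsto hlim ?_
    filter_upwards [hpos] with ε hε
    refine le_of_tendsto (hlam C) ?_
    filter_upwards [eventually_ediam_le hC hε, hfull ε R hε hR,
      hup ε (D + ε + 1) hε (by positivity)] with n h1 h2 h3
    rw [ENNReal.ofReal_add (by positivity) hε.le]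
    -- Replacing `C` by the closure of `C ∩ G n` costs at most `ε` in mass and lets the diameter of
    -- `C ∩ G n` enter the density bound.
    refine (h2 C hC.measurableSet hCR).trans ?_
    gcongr
    rcases (C ∩ G n).eq_empty_or_nonempty with he | hne
    · simp [he]
    · rw [← hD] at h1
      refine (h3 _ isClosed_closure.measurableSet
        (hne.mono fun x hx => ⟨subset_closure hx, hx.2⟩) ?_).trans ?_
      · rw [ediam_closure]
        refine h1.trans_lt ((ENNReal.ofReal_lt_ofReal_iff (by positivity)).2 (by linarith))
      · rw [ediam_closure, ENNReal.ofReal_mul (by positivity), ENNReal.ofReal_pow (by positivity)]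
        gcongr
  · intro x hx r hr
    have hlim : Tendsto (fun ε : ℝ => ENNReal.ofReal ((1 - ε) * (2 * (r - ε)) ^ m)) (𝓝[>] 0)
        (𝓝 (ENNReal.ofReal ((1 - 0) * (2 * (r - 0)) ^ m))) :=
      Tendsto.mono_left ((ENNReal.continuous_ofReal.comp
        (by fun_prop : Continuous fun ε : ℝ => (1 - ε) * (2 * (r - ε)) ^ m)).tendsto 0)
        nhdsWithin_le_nhds
    simp only [sub_zero, one_mul] at hlim
    refine le_of_tendsto hlim ?_
    have hlt : ∀ᶠ ε : ℝ in 𝓝[>] 0, ε < r := nhdsWithin_le_nhds (gt_mem_nhds hr)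
    filter_upwards [hpos, hlt] with ε hε hεr
    refine ge_of_tendsto (hlam _) ?_
    filter_upwards [hx ε hε, hlow ε r hε hr] with n ⟨g, hg1, hg2⟩ h2
    refine (h2 g hg2 (r - ε) (by linarith) (by linarith)).trans
      (measure_mono (ball_subset_ball' ?_))
    rw [mem_ball] at hg1
    linarith

/-! ### Blow-ups at points of uniform density -/

/-- The image of `μ` under `y ↦ r⁻¹ • (y - a)`, normalised to preserve `m`-dimensional densities. -/
noncomputable def blowUp {X : Type*} [NormedAddCommGroup X] [NormedSpace ℝ X] [MeasurableSpace X]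
    (m : ℕ) (μ : Measure X) (a : X) (r : ℝ) : Measure X :=
  (ENNReal.ofReal (r ^ m))⁻¹ • μ.map fun y => r⁻¹ • (y - a)

section BlowUp

variable {X : Type*} [NormedAddCommGroup X] [NormedSpace ℝ X] [MeasurableSpace X] [BorelSpace X]
  {m : ℕ} {μ : Measure X}

theorem blowUp_apply (a : X) (r : ℝ) {S : Set X} (hS : MeasurableSet S) :
    blowUp m μ a r S = (ENNReal.ofReal (r ^ m))⁻¹ * μ ((fun y => r⁻¹ • (y - a)) ⁻¹' S) := by
  rw [blowUp, Measure.smul_apply, Measure.map_apply _ hS, smul_eq_mul]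
  exact Continuous.measurable (by fun_prop)

theorem blowUp_le_iff {a : X} {r : ℝ} (hr : 0 < r) {S : Set X} (hS : MeasurableSet S) {c : ℝ≥0∞} :
    blowUp m μ a r S ≤ c ↔
      μ ((fun y => r⁻¹ • (y - a)) ⁻¹' S) ≤ ENNReal.ofReal (r ^ m) * c := by
  rw [blowUp_apply a r hS, ENNReal.inv_mul_le_iff (ENNReal.ofReal_pos.2 (by positivity)).ne'
    ENNReal.ofReal_ne_top]

theorem le_blowUp_iff {a : X} {r : ℝ} (hr : 0 < r) {S : Set X} (hS : MeasurableSet S) {c : ℝ≥0∞} :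
    c ≤ blowUp m μ a r S ↔
      ENNReal.ofReal (r ^ m) * c ≤ μ ((fun y => r⁻¹ • (y - a)) ⁻¹' S) := by
  have h0 : ENNReal.ofReal (r ^ m) ≠ 0 := (ENNReal.ofReal_pos.2 (by positivity)).ne'
  rw [blowUp_apply a r hS, mul_comm _ (μ _), ← div_eq_mul_inv, ENNReal.le_div_iff_mul_le
    (Or.inl h0) (Or.inl ENNReal.ofReal_ne_top), mul_comm]

omit [MeasurableSpace X] [BorelSpace X] in
theorem ediam_preimage_le (a : X) {r : ℝ} (hr : 0 < r) (S : Set X) :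
    ediam ((fun y => r⁻¹ • (y - a)) ⁻¹' S) ≤ ENNReal.ofReal r * ediam S := by
  refine ediam_le fun y hy z hz => ?_
  calc edist y z = ENNReal.ofReal r * edist (r⁻¹ • (y - a)) (r⁻¹ • (z - a)) := by
        rw [edist_dist, edist_dist, ← ENNReal.ofReal_mul hr.le, dist_eq_norm, dist_eq_norm,
          ← smul_sub, norm_smul, norm_inv, Real.norm_of_nonneg hr.le, sub_sub_sub_cancel_right,
          mul_inv_cancel_left₀ hr.ne']
    _ ≤ _ := by
        gcongr
        exact edist_le_ediam_of_mem hy hz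

theorem UniformUpperDensity.blowUp {G : Set X} (h : UniformUpperDensity m μ G) {a : ℕ → X}
    {r : ℕ → ℝ} (hr : ∀ n, 0 < r n) (hr0 : Tendsto r atTop (𝓝 0)) {ε : ℝ} (hε : 0 < ε) (R : ℝ) :
    ∀ᶠ n in atTop, ∀ S : Set X, MeasurableSet S → (S ∩ {x | a n + r n • x ∈ G}).Nonempty →
      ediam S < ENNReal.ofReal R →
      _root_.blowUp m μ (a n) (r n) S ≤ ENNReal.ofReal (1 + ε) * ediam S ^ m := by
  obtain ⟨ρ, hρ, H⟩ := h ε hε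
  have hlim : Tendsto (fun n => r n * R) atTop (𝓝 0) := by simpa using hr0.mul_const R
  filter_upwards [(tendsto_order.1 hlim).2 ρ hρ] with n hn S hS ⟨x, hxS, hxG⟩ hSR
  have hrn := hr n
  rw [blowUp_le_iff hrn hS]
  have hd := ediam_preimage_le (a n) hrn S
  have h1 := H ((fun y => (r n)⁻¹ • (y - a n)) ⁻¹' S) ⟨a n + r n • x, by
      simpa [hrn.ne'] using hxS, hxG⟩ (by
    refine hd.trans_lt (lt_of_le_of_lt ?_ ((ENNReal.ofReal_lt_ofReal_iff hρ).2 hn))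
    rw [ENNReal.ofReal_mul hrn.le]
    gcongr)
  refine h1.trans ?_
  calc _ ≤ ENNReal.ofReal (1 + ε) * (ENNReal.ofReal (r n) * ediam S) ^ m := by gcongr
    _ = _ := by rw [mul_pow, ENNReal.ofReal_pow hrn.le]; ring

theorem UniformLowerDensity.blowUp {G : Set X} (h : UniformLowerDensity m μ G) {a : ℕ → X}
    {r : ℕ → ℝ} (hr : ∀ n, 0 < r n) (hr0 : Tendsto r atTop (𝓝 0)) {ε : ℝ} (hε : 0 < ε) (R : ℝ) :
    ∀ᶠ n in atTop, ∀ x ∈ {x | a n + r n • x ∈ G}, ∀ s : ℝ, 0 < s → s < R →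
      ENNReal.ofReal ((1 - ε) * (2 * s) ^ m) ≤ _root_.blowUp m μ (a n) (r n) (ball x s) := by
  obtain ⟨ρ, hρ, H⟩ := h ε hε
  have hlim : Tendsto (fun n => r n * R) atTop (𝓝 0) := by simpa using hr0.mul_const R
  filter_upwards [(tendsto_order.1 hlim).2 ρ hρ] with n hn x hx s hs hsR
  have hrn := hr n
  rw [le_blowUp_iff hrn measurableSet_ball, ← ENNReal.ofReal_mul (by positivity)]
  refine le_trans (le_of_eq ?_) ((H _ hx (r n * s) (by positivity)
    (lt_trans (by gcongr) hn)).trans (measure_mono fun y hy => ?_))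
  · congr 1
    rw [show 2 * (r n * s) = r n * (2 * s) by ring, mul_pow]
    ring
  · rw [mem_ball, dist_eq_norm] at hy
    rw [mem_preimage, mem_ball, dist_eq_norm]
    have : (r n)⁻¹ • (y - a n) - x = (r n)⁻¹ • (y - (a n + r n • x)) := by
      rw [← sub_sub, smul_sub _ (y - a n), inv_smul_smul₀ hrn.ne']
    rw [this, norm_smul, norm_inv, Real.norm_of_nonneg hrn.le, inv_mul_lt_iff₀ hrn]
    exact hy

omit [NormedSpace ℝ X] in
/-- At points of uniform lower density of `μ.restrict A`, the complement of `A` is negligible. -/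
theorem exists_measure_ball_diff_le [IsFiniteMeasure μ] {A A' : Set X} (hA : MeasurableSet A)
    (hA'A : A' ⊆ A) (hup : UniformUpperDensity m μ A)
    (hlow : UniformLowerDensity m (μ.restrict A) A') {ε : ℝ} (hε : 0 < ε) :
    ∃ R : ℝ, 0 < R ∧ ∀ x ∈ A', ∀ r : ℝ, 0 < r → r < R →
      μ (ball x r \ A) ≤ ENNReal.ofReal (ε * (2 * r) ^ m) := by
  -- The mass outside `A` is at most the gap between the factors `1 + δ` and `1 - δ`, whence `2δ ≤
  -- ε`; `δ ≤ 1` keeps the lower factor nonnegative.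
  set δ := min (ε / 2) 1 with hδ
  have hδ0 : 0 < δ := by positivity
  have hδ1 : δ ≤ 1 := min_le_right _ _
  have hδε : 2 * δ ≤ ε := by linarith [min_le_left (ε / 2) 1]
  obtain ⟨R₁, hR₁, H₁⟩ := hup δ hδ0
  obtain ⟨R₂, hR₂, H₂⟩ := hlow δ hδ0
  refine ⟨min (R₁ / 2) R₂, by positivity, fun x hx r hr hrR => ?_⟩
  have hr1 : r < R₁ / 2 := hrR.trans_le (min_le_left _ _)
  have hd : ediam (ball x r) ≤ ENNReal.ofReal (2 * r) := by
    refine ediam_le fun y hy z hz => ?_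
    rw [edist_dist]
    rw [mem_ball] at hy hz
    exact ENNReal.ofReal_le_ofReal (by linarith [dist_triangle_right y z x])
  have h1 := H₁ (ball x r) ⟨x, mem_ball_self hr, hA'A hx⟩ (hd.trans_lt
    ((ENNReal.ofReal_lt_ofReal_iff hR₁).2 (by linarith)))
  have h2 := H₂ x hx r hr (hrR.trans_le (min_le_right _ _))
  rw [Measure.restrict_apply measurableSet_ball] at h2
  have h3 := measure_inter_add_sdiff (μ := μ) (ball x r) hA
  have h4 : ENNReal.ofReal ((1 - δ) * (2 * r) ^ m) + μ (ball x r \ A) ≤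
      ENNReal.ofReal ((1 - δ) * (2 * r) ^ m) + ENNReal.ofReal (2 * δ * (2 * r) ^ m) := by
    calc _ ≤ μ (ball x r ∩ A) + μ (ball x r \ A) := by gcongr
      _ = μ (ball x r) := h3
      _ ≤ ENNReal.ofReal (1 + δ) * ENNReal.ofReal (2 * r) ^ m := h1.trans (by gcongr)
      _ = _ := by
        rw [← ENNReal.ofReal_pow (by positivity), ← ENNReal.ofReal_mul (by positivity),
          ← ENNReal.ofReal_add (mul_nonneg (by linarith) (by positivity)) (by positivity)]
        congr 1
        ring
  refine ((ENNReal.add_le_add_iff_left ENNReal.ofReal_ne_top).1 h4).trans ?_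
  gcongr

/-- Mass outside the rescaled `E ∩ A` comes from `Eᶜ`, which is null, or from `Aᶜ`, which is
negligible near the centres `a n ∈ A'`. -/
theorem eventually_blowUp_le_closure [IsFiniteMeasure μ] {E A A' : Set X} (hA : MeasurableSet A)
    (hA'A : A' ⊆ A) (hE : μ Eᶜ = 0) (hup : UniformUpperDensity m μ A)
    (hlow : UniformLowerDensity m (μ.restrict A) A') {a : ℕ → X} (ha : ∀ n, a n ∈ A')
    {r : ℕ → ℝ} (hr : ∀ n, 0 < r n) (hr0 : Tendsto r atTop (𝓝 0)) {ε R : ℝ} (hε : 0 < ε)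
    (hR : 0 < R) :
    ∀ᶠ n in atTop, ∀ C : Set X, MeasurableSet C → C ⊆ ball 0 R → blowUp m μ (a n) (r n) C ≤
      blowUp m μ (a n) (r n) (closure (C ∩ {x | a n + r n • x ∈ E ∩ A})) + ENNReal.ofReal ε := by
  -- At radius `r n * R` this constant gives the bound `ε (r n)^m`, which normalisation turns into
  -- `ε`.
  obtain ⟨ρ, hρ, H⟩ := exists_measure_ball_diff_le hA hA'A hup hlow
    (ε := ε / (2 * R) ^ m) (by positivity)
  have hlim : Tendsto (fun n => r n * R) atTop (𝓝 0) := by simpa using hr0.mul_const R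
  filter_upwards [(tendsto_order.1 hlim).2 ρ hρ] with n hn C hC hCR
  have hrn := hr n
  have hr0 : ENNReal.ofReal (r n ^ m) ≠ 0 := (ENNReal.ofReal_pos.2 (by positivity)).ne'
  rw [blowUp_le_iff hrn hC, blowUp_apply _ _ isClosed_closure.measurableSet, mul_add,
    ← mul_assoc, ENNReal.mul_inv_cancel hr0 ENNReal.ofReal_ne_top, one_mul]
  have h1 := H (a n) (ha n) (r n * R) (by positivity) hn
  have h2 : (fun y => (r n)⁻¹ • (y - a n)) ⁻¹' C ⊆
      ((fun y => (r n)⁻¹ • (y - a n)) ⁻¹' closure (C ∩ {x | a n + r n • x ∈ E ∩ A}) ∪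
      (ball (a n) (r n * R) \ A)) ∪ Eᶜ := by
    intro y hy
    by_cases hyE : y ∈ E
    · left
      by_cases hyA : y ∈ A
      · left
        refine subset_closure ⟨hy, ?_⟩
        rw [mem_ofPred_eq, smul_inv_smul₀ hrn.ne', add_sub_cancel]
        exact ⟨hyE, hyA⟩
      · right
        refine ⟨?_, hyA⟩
        have h3 := hCR hy
        rw [mem_ball, dist_zero_right, norm_smul, norm_inv, Real.norm_of_nonneg hrn.le,
          inv_mul_lt_iff₀ hrn] at h3
        rwa [mem_ball, dist_eq_norm]
    · exact Or.inr hyE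
  refine (measure_mono h2).trans ((measure_union_le _ _).trans ?_)
  rw [hE, add_zero]
  refine (measure_union_le _ _).trans ?_
  gcongr
  refine h1.trans (le_of_eq ?_)
  rw [← ENNReal.ofReal_mul (by positivity)]
  congr 1
  have hR' : (2 * R) ^ m ≠ 0 := by positivity
  rw [show 2 * (r n * R) = r n * (2 * R) by ring, mul_pow (r n), div_mul_eq_mul_div, div_eq_iff hR']
  ring

end BlowUp

/-! ### Planes as tangents, and the approximation theorem -/

/-- Every ultralimit of blow-ups of a set with uniform unit density is an `m`-plane. -/
theorem exists_submodule_ultralimitSet_eq {X : Type*} [NormedAddCommGroup X] [NormedSpace ℝ X]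
    [StrictConvexSpace ℝ X] [FiniteDimensional ℝ X] [MeasurableSpace X] [BorelSpace X] {m : ℕ}
    {μ : Measure X} [IsFiniteMeasure μ] {E A A' : Set X} (hA : MeasurableSet A) (hA'A : A' ⊆ A)
    (hE : μ Eᶜ = 0) (hup : UniformUpperDensity m μ A) (hlo : UniformLowerDensity m μ A)
    (hlow : UniformLowerDensity m (μ.restrict A) A') {a : ℕ → X} (ha : ∀ n, a n ∈ E ∩ A')
    {r : ℕ → ℝ} (hr : ∀ n, 0 < r n) (hr0 : Tendsto r atTop (𝓝 0)) (u : Ultrafilter ℕ)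
    (hu : (u : Filter ℕ) ≤ atTop) :
    ∃ V : Submodule ℝ X, Module.finrank ℝ V = m ∧
      ultralimitSet u (fun n => {x | a n + r n • x ∈ E ∩ A}) = (V : Set X) := by
  have hsub : ∀ n, {x | a n + r n • x ∈ E ∩ A} ⊆ {x | a n + r n • x ∈ A} :=
    fun n x hx => hx.2
  obtain ⟨lam, hlam⟩ := exists_isUnitDensityContent (m := m) u
    (fun n => {x | a n + r n • x ∈ E ∩ A}) (fun n => blowUp m μ (a n) (r n))
    (fun n => by
      have := ha n
      simpa using ⟨this.1, hA'A this.2⟩)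
    (fun ε R hε _ => hu <| (hup.blowUp hr hr0 hε R).mono fun n hn S hS hne =>
      hn S hS (hne.mono (inter_subset_inter_right _ (hsub n))))
    (fun ε R hε _ => hu <| (hlo.blowUp hr hr0 hε R).mono fun n hn x hx => hn x (hsub n hx))
    (fun ε R hε hR => hu <| eventually_blowUp_le_closure hA hA'A hE hup hlow
      (fun n => (ha n).2) hr hr0 hε hR)
  exact hlam.exists_submodule_eq

/-- Approximation by planes for a set with uniform unit density. -/
theorem exists_radius_forall_exists_plane {d m : ℕ} {X : Type*} [NormedAddCommGroup X]
    [NormedSpace ℝ X] [StrictConvexSpace ℝ X] [MeasurableSpace X] [BorelSpace X]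
    (T : X ≃ₗ[ℝ] EuclideanSpace ℝ (Fin d)) {L : ℝ} (hL : 0 < L)
    (hTL : ∀ x : X, L⁻¹ * ‖x‖ ≤ ‖T x‖ ∧ ‖T x‖ ≤ L * ‖x‖)
    {μ : Measure X} [IsFiniteMeasure μ] {E A A' : Set X} (hA : MeasurableSet A) (hA'A : A' ⊆ A)
    (hE : μ Eᶜ = 0) (hup : UniformUpperDensity m μ A) (hlo : UniformLowerDensity m μ A)
    (hlow : UniformLowerDensity m (μ.restrict A) A') {κ : ℝ} (hκ : 0 < κ) :
    ∃ R : ℝ, 0 < R ∧ ∀ a ∈ E ∩ A', ∀ r : ℝ, 0 < r → r < R →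
      ∃ V : AffineSubspace ℝ (EuclideanSpace ℝ (Fin d)), IsMPlaneThrough m (T a) V ∧
        (T '' (E ∩ A')) ∩
          (ball (T a) r \ thickening (κ * r) (V : Set (EuclideanSpace ℝ (Fin d)))) = ∅ ∧
        (V : Set (EuclideanSpace ℝ (Fin d))) ∩ ball (T a) r ⊆ thickening (κ * r) (T '' E) := by
  have : FiniteDimensional ℝ X := LinearEquiv.finiteDimensional T.symm
  have : ProperSpace X := FiniteDimensional.proper ℝ X
  by_contra! hcon
  choose a ha r hr hrn hbad using fun n : ℕ => hcon (1 / (n + 1)) Nat.one_div_pos_of_nat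
  have hr0 : Tendsto r atTop (𝓝 0) :=
    squeeze_zero (fun n => (hr n).le) (fun n => (hrn n).le) tendsto_one_div_add_atTop_nhds_zero_nat
  let u : Ultrafilter ℕ := hyperfilter ℕ
  have hu : (u : Filter ℕ) ≤ atTop := Nat.hyperfilter_le_atTop
  obtain ⟨V, hVm, hKV⟩ := exists_submodule_ultralimitSet_eq hA hA'A hE hup hlo hlow ha hr hr0 u hu
  set G : ℕ → Set X := fun n => {x | a n + r n • x ∈ E ∩ A} with hG
  have hTc : Continuous T := T.toLinearMap.continuous_of_finiteDimensional
  -- One limit subspace `V` supplies the candidate planes at all the bad centres.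
  let P : ℕ → AffineSubspace ℝ (EuclideanSpace ℝ (Fin d)) := fun n =>
    AffineSubspace.mk' (T (a n)) (V.map T.toLinearMap)
  have hPm : ∀ n, IsMPlaneThrough m (T (a n)) (P n) := fun n => by
    refine ⟨AffineSubspace.self_mem_mk' _ _, ?_⟩
    rw [AffineSubspace.direction_mk', LinearEquiv.finrank_map_eq, hVm]
  have hnorm : ∀ x : X, ‖T x‖ < 1 → x ∈ closedBall (0 : X) L := fun x hx => by
    rw [mem_closedBall, dist_zero_right]
    have := (hTL x).1
    rw [inv_mul_le_iff₀ hL] at this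
    nlinarith
  have hscale : ∀ n (x : X), T (a n + r n • x) = T (a n) + r n • T x := fun n x => by simp
  have hdist : ∀ n (x y : X), dist (T (a n + r n • x)) (T (a n + r n • y)) =
      r n * ‖T (x - y)‖ := fun n x y => by
    rw [dist_eq_norm, hscale, hscale, add_sub_add_left_eq_sub, ← smul_sub, norm_smul,
      Real.norm_of_nonneg (hr n).le, ← map_sub]
  have hunscale : ∀ n (y : X), ∃ x : X, y = a n + r n • x := fun n y =>
    ⟨(r n)⁻¹ • (y - a n), by rw [smul_inv_smul₀ (hr n).ne']; abel⟩
  have hball : ∀ n (x : X), T (a n + r n • x) ∈ ball (T (a n)) (r n) → ‖T x‖ < 1 := by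
    intro n x hx
    have h1 := hdist n x 0
    rw [smul_zero, add_zero, sub_zero] at h1
    rw [mem_ball, h1] at hx
    have := hr n
    by_contra! h2
    nlinarith
  -- Rescaled offending points stay in a compact ball, so they converge to some `y ∈ V`, whose image
  -- in the plane is eventually within `κ r n`.
  have hcond1 : ∀ᶠ n in (u : Filter ℕ), (T '' (E ∩ A')) ∩ (ball (T (a n)) (r n) \
      thickening (κ * r n) (P n : Set (EuclideanSpace ℝ (Fin d)))) = ∅ := by
    by_contra hne
    rw [← Ultrafilter.eventually_not] at hne
    have hex : ∀ n, ∃ x : X, ¬ (T '' (E ∩ A')) ∩ (ball (T (a n)) (r n) \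
        thickening (κ * r n) (P n : Set (EuclideanSpace ℝ (Fin d)))) = ∅ →
        x ∈ closedBall 0 L ∩ G n ∧
        T (a n + r n • x) ∉ thickening (κ * r n) (P n : Set (EuclideanSpace ℝ (Fin d))) := by
      intro n
      by_cases hn : (T '' (E ∩ A')) ∩ (ball (T (a n)) (r n) \
        thickening (κ * r n) (P n : Set (EuclideanSpace ℝ (Fin d)))) = ∅
      · exact ⟨0, fun h => absurd hn h⟩
      · obtain ⟨_, ⟨y, hy, rfl⟩, hyb, hyt⟩ := nonempty_iff_ne_empty.2 hn
        obtain ⟨x, rfl⟩ := hunscale n y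
        exact ⟨x, fun _ => ⟨⟨hnorm x (hball n x hyb), hy.1, hA'A hy.2⟩, hyt⟩⟩
    choose x hx using hex
    have hx' := hne.mono hx
    obtain ⟨y, hy, hlim⟩ := exists_tendsto_mem_ultralimitSet (isCompact_closedBall (0 : X) L)
      (hx'.mono fun n h => h.1)
    rw [hKV] at hy
    have hlim' : Tendsto (fun n => ‖T (x n - y)‖) u (𝓝 0) := by
      have := ((hTc.tendsto _).comp (hlim.sub_const y)).norm
      simpa using this
    obtain ⟨n, hn1, hn2⟩ := (hx'.and ((tendsto_order.1 hlim').2 κ hκ)).exists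
    refine hn1.2 (mem_thickening_iff.2 ⟨T (a n + r n • y), ?_, ?_⟩)
    · change T (a n + r n • y) ∈ P n
      rw [hscale, AffineSubspace.mem_mk', vsub_eq_sub, add_sub_cancel_left, ← map_smul]
      exact Submodule.mem_map_of_mem (V.smul_mem _ hy.2)
    · rw [hdist, mul_comm κ]
      exact mul_lt_mul_of_pos_left hn2 (hr n)
  have hcond2 : ∀ᶠ n in (u : Filter ℕ), (P n : Set (EuclideanSpace ℝ (Fin d))) ∩
      ball (T (a n)) (r n) ⊆ thickening (κ * r n) (T '' E) := by
    by_contra hne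
    rw [← Ultrafilter.eventually_not] at hne
    have hex : ∀ n, ∃ x : X, ¬ (P n : Set (EuclideanSpace ℝ (Fin d))) ∩
        ball (T (a n)) (r n) ⊆ thickening (κ * r n) (T '' E) →
        x ∈ closedBall 0 L ∩ (V : Set X) ∧
        T (a n + r n • x) ∉ thickening (κ * r n) (T '' E) := by
      intro n
      by_cases hn : (P n : Set (EuclideanSpace ℝ (Fin d))) ∩
        ball (T (a n)) (r n) ⊆ thickening (κ * r n) (T '' E)
      · exact ⟨0, fun h => absurd hn h⟩
      · obtain ⟨z, ⟨hzP, hzb⟩, hzt⟩ := not_subset.1 hn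
        obtain ⟨y, rfl⟩ := T.surjective z
        obtain ⟨x, rfl⟩ := hunscale n y
        refine ⟨x, fun _ => ⟨⟨hnorm x (hball n x hzb), ?_⟩, hzt⟩⟩
        change T (a n + r n • x) ∈ P n at hzP
        rw [hscale, AffineSubspace.mem_mk', vsub_eq_sub, add_sub_cancel_left, ← map_smul] at hzP
        obtain ⟨v, hv, hvx⟩ := hzP
        have hv' : v = r n • x := T.injective hvx
        have := V.smul_mem (r n)⁻¹ hv
        rwa [hv', inv_smul_smul₀ (hr n).ne'] at this
    choose x hx using hex
    have hx' := hne.mono hx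
    have hC : IsCompact (closedBall (0 : X) L ∩ (V : Set X)) :=
      (isCompact_closedBall _ _).inter_right V.closed_of_finiteDimensional
    obtain ⟨y, hy, hlim⟩ := hC.exists_tendsto_ultrafilter u (hx'.mono fun n h => h.1)
    have hyK : y ∈ ultralimitSet u G := by rw [hKV]; exact hy.2
    -- The point `x n` and a point of `G n` are both within `ρ` of `y`, and `T` stretches by at most
    -- `L`, so `2ρL = κ` suffices.
    set ρ := κ / (2 * L) with hρ
    have hρ0 : 0 < ρ := by positivity
    obtain ⟨n, hn1, hn2, g, hg1, hg2⟩ :=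
      (hx'.and ((hlim.eventually (ball_mem_nhds y hρ0)).and (hyK ρ hρ0))).exists
    refine hn1.2 (mem_thickening_iff.2 ⟨T (a n + r n • g), mem_image_of_mem _ hg2.1, ?_⟩)
    rw [hdist, mul_comm κ]
    refine mul_lt_mul_of_pos_left (lt_of_le_of_lt (hTL _).2 ?_) (hr n)
    rw [← dist_eq_norm]
    rw [mem_ball] at hg1
    have h1 : dist (x n) g < 2 * ρ := by linarith [dist_triangle_right (x n) g y]
    calc L * dist (x n) g < L * (2 * ρ) := by gcongr
      _ = κ := by rw [hρ]; field_simp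
  obtain ⟨n, hn1, hn2⟩ := (hcond1.and hcond2).exists
  exact hbad n (P n) (hPm n) hn1 hn2

/-- The space `X` is `ℝ^d` with the given strictly convex norm; the linear isomorphism `T` to
`EuclideanSpace ℝ (Fin d)` is its identification with coordinate space, so that the Euclidean norm
of `x : X` is `‖T x‖`, the Euclidean copy of a set `A` is `T '' A`, and `μH[m] (T '' A)` is its
Euclidean Hausdorff measure. -/
theorem mainTheorem5 {d m : ℕ} {X : Type*} [NormedAddCommGroup X] [NormedSpace ℝ X]
    [StrictConvexSpace ℝ X] [MeasurableSpace X] [BorelSpace X]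
    (T : X ≃ₗ[ℝ] EuclideanSpace ℝ (Fin d))
    (L : ℝ) (hL : 1 < L) (hTL : ∀ x : X, L⁻¹ * ‖x‖ ≤ ‖T x‖ ∧ ‖T x‖ ≤ L * ‖x‖)
    (E : Set X) (hE : IsMRegular m E)
    (η : ℝ) (hη : 0 < η) (μ : ℝ) (hμ : 0 < μ) (hμL : μ < (L ^ 2)⁻¹) :
    ∃ R : ℝ, 0 < R ∧ ∃ Estar : Set X, Estar ⊆ E ∧ IsMSet m Estar ∧
      (μH[(m : ℝ)] : Measure (EuclideanSpace ℝ (Fin d))) (T '' (E \ Estar)) < ENNReal.ofReal η ∧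
      ∀ a ∈ Estar, ∀ r : ℝ, 0 < r → r < R →
        ∃ V : AffineSubspace ℝ (EuclideanSpace ℝ (Fin d)), IsMPlaneThrough m (T a) V ∧
          (T '' Estar) ∩ (ball (T a) r \ thickening (μ * r) (V : Set (EuclideanSpace ℝ (Fin d))))
            = ∅ ∧
          (V : Set (EuclideanSpace ℝ (Fin d))) ∩ ball (T a) r ⊆ thickening (μ * r) (T '' E) := by
  have : FiniteDimensional ℝ X := LinearEquiv.finiteDimensional T.symm
  have hL0 : 0 < L := zero_lt_one.trans hL
  set H : Measure X := μH[(m : ℝ)] with hH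
  have hfin : IsFiniteMeasure (H.restrict E) := ⟨by simpa using hE.isMSet.lt_top⟩
  have hEnull := nullMeasurableSet_of_isCaratheodory hE.isMSet.measurable hE.isMSet.lt_top.ne
  have hEc : H.restrict E Eᶜ = 0 := by
    rw [Measure.restrict_apply₀' hEnull, compl_inter_self, measure_empty]
  have hLm0 : ENNReal.ofReal L ^ (m : ℝ) ≠ 0 := by
    rw [ENNReal.rpow_natCast]
    exact pow_ne_zero _ (ENNReal.ofReal_pos.2 hL0).ne'
  have hLmtop : ENNReal.ofReal L ^ (m : ℝ) ≠ ∞ := by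
    rw [ENNReal.rpow_natCast]
    exact ENNReal.pow_ne_top ENNReal.ofReal_ne_top
  -- The first bound absorbs the Lipschitz factor `L^m` of `T`; the second forces `E ∩ A'` to have
  -- positive measure.
  have hη' : 0 < min (ENNReal.ofReal η / ENNReal.ofReal L ^ (m : ℝ)) (H E) :=
    lt_min (ENNReal.div_pos (ENNReal.ofReal_pos.2 hη).ne' hLmtop) hE.isMSet.pos
  obtain ⟨A, A', hA, hA', hA'A, hA'η, hup, hlo, hlow⟩ :=
    hE.exists_uniformDensity hη' (H.restrict E) rfl
  have hdiff : H (E \ (E ∩ A')) = H.restrict E A'ᶜ := by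
    rw [Measure.restrict_apply hA'.compl, sdiff_self_inter, inter_comm, sdiff_eq]
  obtain ⟨R, hR, hplane⟩ := exists_radius_forall_exists_plane T hL0 hTL hA hA'A hEc hup hlo hlow hμ
  refine ⟨R, hR, E ∩ A', inter_subset_left, ⟨?_, ?_, ?_⟩, ?_, hplane⟩
  · exact OuterMeasure.isCaratheodory_inter _ hE.isMSet.measurable
      (le_toOuterMeasure_caratheodory H _ hA')
  · by_contra h0
    have h1 : H E ≤ H (E ∩ A') + H (E \ (E ∩ A')) := by
      refine (measure_mono ?_).trans (measure_union_le _ _)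
      rw [union_sdiff_self]
      exact subset_union_right
    rw [nonpos_iff_eq_zero.1 (not_lt.1 h0), zero_add, hdiff] at h1
    exact absurd (hA'η.trans_le (min_le_right _ _)) (not_lt.2 h1)
  · exact (measure_mono inter_subset_left).trans_lt hE.isMSet.lt_top
  · have hlip : LipschitzWith L.toNNReal T := by
      refine LipschitzWith.of_dist_le_mul fun x y => ?_
      rw [dist_eq_norm, dist_eq_norm, ← map_sub, Real.coe_toNNReal _ hL0.le]
      exact (hTL _).2
    refine (hlip.hausdorffMeasure_image_le (Nat.cast_nonneg m) _).trans_lt ?_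
    change ENNReal.ofReal L ^ (m : ℝ) * H (E \ (E ∩ A')) < _
    rw [hdiff]
    exact ENNReal.mul_lt_of_lt_div' (hA'η.trans_le (min_le_left _ _))
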